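/- Throughout, $\Omega\subseteq\mathbb{R}^2$ is a simply connected, bounded, polygonal Lipschitz domain. A regular triangulation $\mathcal{T}$ of $\Omega$ is a finite set of closed (non-degenerate) triangles with $\overline\Omega=\bigcup\mathcal{T}$ such that any two distinct triangles are either disjoint or share exactly one common edge or one vertex. For a regular triangulation $\mathcal{T}$ of $\Omega$ and $m\in\mathbb{N}\cup\{0\}$ let $P_m(\mathcal{T};\mathbb{R}^n)$ be the space of functions $\Omega\to\mathbb{R}^n$ (identified when they agree almost everywhere) each of whose components coincides on each $T\in\mathcal{T}$ with a polynomial of total degree at most $m$, and $P_m(\mathcal{T})=P_m(\mathcal{T};\mathbb{R})$. Fix $k\in\mathbb{N}\cup\{0\}$ and set $$X_h(\mathcal{T})=P_k(\mathcal{T};\mathbb{R}^2),\qquad Y_h(\mathcal{T})=P_{k+1}(\mathcal{T})\cap\Big\{\beta\in H^1(\Omega)\ \Big|\ \int_\Omega\beta\,dx=0\Big\},$$ $$W_h(\mathcal{T})=\{q_h\in X_h(\mathcal{T})\mid (q_h,\operatorname{Curl}\beta_h)_{L^2(\Omega)}=0\text{ for all }\beta_h\in Y_h(\mathcal{T})\},$$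 where $\operatorname{Curl}\beta=(\partial\beta/\partial x_2,-\partial\beta/\partial x_1)$. Let $\Pi_{X_h(\mathcal{T})}$ be the $L^2(\Omega;\mathbb{R}^2)$-orthogonal projection onto $X_h(\mathcal{T})$. A regular triangulation $\mathcal{T}_\star$ of $\Omega$ is an admissible refinement of $\mathcal{T}$ if each triangle of $\mathcal{T}_\star$ is contained in a triangle of $\mathcal{T}$, and $\mathcal{T}$ and $\mathcal{T}_\star$ can both be created by newest-vertex bisection from a common regular triangulation $\mathcal{T}_0$ of $\Omega$ each of whose triangles is equipped with a refinement edge. **Lemma (projection property).** Let $\mathcal{T}$ be a regular triangulation of $\Omega$. Then $$W_h(\mathcal{T})=\Pi_{X_h(\mathcal{T})}\nabla H^1_0(\Omega).$$ Moreover, if $\mathcal{T}_\star$ is an admissible refinement of $\mathcal{T}$, then $$\Pi_{X_h(\mathcal{T})}W_h(\mathcal{T}_\star)=W_h(\mathcal{T}).$$ -/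

import Mathlib

namespace DiscGrad

open MeasureTheory Filter Topology
open scoped ContDiff NNReal ENNReal

noncomputable section

/-- The Euclidean plane `ℝ²`. -/
abbrev Plane : Type := EuclideanSpace ℝ (Fin 2)

/-! ### Domains -/

/-- `Ω` has a Lipschitz boundary: near each boundary point and after a linear isometric change of
coordinates, `Ω` is the set of points strictly above the graph of a Lipschitz function. -/
def HasLipschitzBoundary (Ω : Set Plane) : Prop :=
  ∀ x ∈ frontier Ω, ∃ (e : Plane ≃ₗᵢ[ℝ] Plane) (γ : ℝ → ℝ) (L : ℝ≥0), LipschitzWith L γ ∧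
    ∀ᶠ y in 𝓝 x, (y ∈ Ω ↔ γ (e y 0) < e y 1)

/-- The boundary of `Ω` is a finite union of line segments. -/
def HasPolygonalBoundary (Ω : Set Plane) : Prop :=
  ∃ S : Set (Plane × Plane), S.Finite ∧ frontier Ω = ⋃ s ∈ S, segment ℝ s.1 s.2

/-- `Ω` is a simply connected (in particular nonempty and connected), bounded, polygonal
Lipschitz domain in the plane. -/
structure IsPolygonalDomain (Ω : Set Plane) : Prop where
  isOpen : IsOpen Ω
  isBounded : Bornology.IsBounded Ω
  isSimplyConnected : IsSimplyConnected Ω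
  polygonal : HasPolygonalBoundary Ω
  lipschitz : HasLipschitzBoundary Ω

/-! ### Triangulations -/

/-- A regular triangulation of `Ω`. A closed triangle is given by the set `t` of its three vertices
(affinely independent points); the triangle itself is `convexHull ℝ t`. The triangles cover the
closure of `Ω`, and two distinct triangles meet exactly in the convex hull of their common
vertices, i.e. they are disjoint or share exactly one vertex or exactly one edge. -/
structure Triangulation (Ω : Set Plane) where
  triangles : Set (Finset Plane)
  finite : triangles.Finite
  card_eq_three : ∀ t ∈ triangles, t.card = 3
  affineIndependent : ∀ t ∈ triangles, AffineIndependent ℝ ((↑) : t → Plane)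
  cover : ⋃ t ∈ triangles, convexHull ℝ (t : Set Plane) = closure Ω
  inter : ∀ t ∈ triangles, ∀ t' ∈ triangles, t ≠ t' →
    convexHull ℝ (t : Set Plane) ∩ convexHull ℝ (t' : Set Plane) =
      convexHull ℝ ((t : Set Plane) ∩ (t' : Set Plane))

/-- `𝒯'` is a refinement of `𝒯`: each triangle of `𝒯'` is contained in a triangle of `𝒯`. -/
def Refines {Ω : Set Plane} (𝒯' 𝒯 : Triangulation Ω) : Prop :=
  ∀ t' ∈ 𝒯'.triangles, ∃ t ∈ 𝒯.triangles,
    convexHull ℝ (t' : Set Plane) ⊆ convexHull ℝ (t : Set Plane)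

/-! ### Newest-vertex bisection -/

/-- A triangle `conv {peak, a, b}` together with its refinement edge, the edge `[a, b]`
opposite to the vertex `peak`. -/
structure MarkedTriangle where
  peak : Plane
  a : Plane
  b : Plane

/-- The vertex set of a marked triangle. -/
def MarkedTriangle.vertices (τ : MarkedTriangle) : Finset Plane :=
  haveI := Classical.decEq Plane
  {τ.peak, τ.a, τ.b}

/-- The two children of `τ` under newest-vertex bisection: `τ` is split along the segment from
`peak` to the midpoint of its refinement edge; the midpoint is the newest vertex of both children,
and the refinement edge of each child is the edge opposite to it. -/
def MarkedTriangle.children (τ : MarkedTriangle) : Set MarkedTriangle :=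
  {⟨midpoint ℝ τ.a τ.b, τ.peak, τ.a⟩, ⟨midpoint ℝ τ.a τ.b, τ.peak, τ.b⟩}

/-- `M'` arises from the collection `M` of marked triangles by bisecting one of its members. -/
def BisectionStep (M M' : Set MarkedTriangle) : Prop :=
  ∃ τ ∈ M, M' = (M \ {τ}) ∪ τ.children

/-- `M₀` equips each triangle of `𝒯₀` with exactly one refinement edge. -/
def IsMarking {Ω : Set Plane} (𝒯₀ : Triangulation Ω) (M₀ : Set MarkedTriangle) : Prop :=
  Set.BijOn MarkedTriangle.vertices M₀ 𝒯₀.triangles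

/-- The regular triangulation `𝒯` is admissible with respect to the initial marked triangulation
`M₀`: it can be created from it by finitely many newest-vertex bisections. -/
def IsAdmissible {Ω : Set Plane} (M₀ : Set MarkedTriangle) (𝒯 : Triangulation Ω) : Prop :=
  ∃ M : Set MarkedTriangle, Relation.ReflTransGen BisectionStep M₀ M ∧
    MarkedTriangle.vertices '' M = 𝒯.triangles

/-- `𝒯'` is an admissible refinement of `𝒯`: both are admissible with respect to a common initial
triangulation `𝒯₀` with refinement edges (`𝒯₀ = 𝒯` is allowed), and `𝒯'` refines `𝒯`. -/
def IsAdmissibleRefinement {Ω : Set Plane} (𝒯' 𝒯 : Triangulation Ω) : Prop :=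
  ∃ (𝒯₀ : Triangulation Ω) (M₀ : Set MarkedTriangle), IsMarking 𝒯₀ M₀ ∧
    IsAdmissible M₀ 𝒯 ∧ IsAdmissible M₀ 𝒯' ∧ Refines 𝒯' 𝒯

/-! ### Lebesgue and Sobolev spaces -/

/-- `L²(Ω)`. -/
abbrev L2 (Ω : Set Plane) : Type := Lp ℝ 2 (volume.restrict Ω)

/-- `L²(Ω; ℝ²)`, with its standard scalar product. -/
abbrev L2Vec (Ω : Set Plane) : Type := Lp Plane 2 (volume.restrict Ω)

/-- `φ ∈ C_c^∞(Ω)`. -/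
structure IsTestFunction (Ω : Set Plane) (φ : Plane → ℝ) : Prop where
  smooth : ContDiff ℝ ∞ φ
  compact : HasCompactSupport φ
  support : tsupport φ ⊆ Ω

/-- `g ∈ L²(Ω; ℝ²)` is the weak gradient of `u ∈ L²(Ω)`. -/
def HasWeakGradient {Ω : Set Plane} (u : L2 Ω) (g : L2Vec Ω) : Prop :=
  ∀ φ : Plane → ℝ, IsTestFunction Ω φ →
    ∫ x in Ω, u x • gradient φ x = - ∫ x in Ω, φ x • g x

/-- `H¹(Ω)`, the functions in `L²(Ω)` with a weak gradient in `L²(Ω; ℝ²)`. -/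
def H1 (Ω : Set Plane) : Set (L2 Ω) :=
  {u | ∃ g : L2Vec Ω, HasWeakGradient u g}

/-- `L²₀(Ω)`, the functions in `L²(Ω)` with vanishing integral mean. -/
def L2Zero (Ω : Set Plane) : Set (L2 Ω) :=
  {u | ∫ x in Ω, u x = 0}

/-- `H¹₀(Ω)`, the closure of `C_c^∞(Ω)` in `H¹(Ω)`. -/
def H1Zero (Ω : Set Plane) : Set (L2 Ω) :=
  {u | ∃ g : L2Vec Ω, HasWeakGradient u g ∧
    ∃ φ : ℕ → Plane → ℝ, (∀ n, IsTestFunction Ω (φ n)) ∧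
      Tendsto (fun n ↦ eLpNorm (fun x ↦ φ n x - u x) 2 (volume.restrict Ω)) atTop (𝓝 0) ∧
      Tendsto (fun n ↦ eLpNorm (fun x ↦ gradient (φ n) x - g x) 2 (volume.restrict Ω))
        atTop (𝓝 0)}

/-- `∇H¹₀(Ω) ⊆ L²(Ω; ℝ²)`. -/
def gradH1Zero (Ω : Set Plane) : Set (L2Vec Ω) :=
  {g | ∃ u ∈ H1Zero Ω, HasWeakGradient u g}

/-- `c ∈ L²(Ω; ℝ²)` is the weak Curl `(∂β/∂x₂, -∂β/∂x₁)` of `β ∈ L²(Ω)`. -/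
def HasWeakCurl {Ω : Set Plane} (β : L2 Ω) (c : L2Vec Ω) : Prop :=
  ∃ g : L2Vec Ω, HasWeakGradient β g ∧
    ∀ᵐ x ∂(volume.restrict Ω), c x 0 = g x 1 ∧ c x 1 = - g x 0

/-! ### Discrete spaces -/

/-- `f` coincides almost everywhere on each triangle of `𝒯` with a polynomial of total degree at
most `k`. -/
def IsPiecewisePoly {Ω : Set Plane} (𝒯 : Triangulation Ω) (k : ℕ) (f : Plane → ℝ) : Prop :=
  ∀ t ∈ 𝒯.triangles, ∃ p : MvPolynomial (Fin 2) ℝ, p.totalDegree ≤ k ∧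
    ∀ᵐ x ∂(volume.restrict Ω), x ∈ convexHull ℝ (t : Set Plane) →
      f x = MvPolynomial.eval (fun i ↦ x i) p

/-- `X_h(𝒯) = P_k(𝒯; ℝ²)` as a subspace of `L²(Ω; ℝ²)`. -/
def Xh {Ω : Set Plane} (𝒯 : Triangulation Ω) (k : ℕ) : Submodule ℝ (L2Vec Ω) where
  carrier := {q | ∀ i : Fin 2, IsPiecewisePoly 𝒯 k (fun x ↦ q x i)}
  zero_mem' := by
    intro i t _
    refine ⟨0, by simp, ?_⟩
    filter_upwards [Lp.coeFn_zero Plane 2 (volume.restrict Ω)] with x hx _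
    simpa using congrArg (fun v : Plane ↦ v i) hx
  add_mem' := by
    intro q r hq hr i t ht
    obtain ⟨p, hp, hpq⟩ := hq i t ht
    obtain ⟨s, hs, hsr⟩ := hr i t ht
    refine ⟨p + s, (MvPolynomial.totalDegree_add p s).trans (max_le hp hs), ?_⟩
    filter_upwards [Lp.coeFn_add q r, hpq, hsr] with x hx h1 h2 hxt
    have h3 : (q + r : L2Vec Ω) x i = q x i + r x i := congrArg (fun v : Plane ↦ v i) hx
    change (q + r : L2Vec Ω) x i = _
    rw [h3, h1 hxt, h2 hxt, map_add]
  smul_mem' := by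
    intro c q hq i t ht
    obtain ⟨p, hp, hpq⟩ := hq i t ht
    refine ⟨c • p, (MvPolynomial.totalDegree_smul_le c p).trans hp, ?_⟩
    filter_upwards [Lp.coeFn_smul c q, hpq] with x hx h1 hxt
    simp [hx, h1 hxt, MvPolynomial.smul_eval]

/-- `Y_h(𝒯) = P_{k+1}(𝒯) ∩ H¹(Ω) ∩ L²₀(Ω)`. -/
def Yh {Ω : Set Plane} (𝒯 : Triangulation Ω) (k : ℕ) : Set (L2 Ω) :=
  {β | IsPiecewisePoly 𝒯 (k + 1) β ∧ β ∈ H1 Ω ∧ β ∈ L2Zero Ω}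

/-- The discrete orthogonal gradients
`W_h(𝒯) = {q ∈ X_h(𝒯) ∣ (q, Curl β)_{L²(Ω)} = 0 for all β ∈ Y_h(𝒯)}`. -/
def Wh {Ω : Set Plane} (𝒯 : Triangulation Ω) (k : ℕ) : Set (L2Vec Ω) :=
  {q | q ∈ Xh 𝒯 k ∧ ∀ β ∈ Yh 𝒯 k, ∀ c : L2Vec Ω, HasWeakCurl β c → inner ℝ q c = 0}

/-- Pairs of a choice of polynomials on the triangles and an `L²` field they represent. -/
def polyGraph {Ω : Set Plane} (𝒯 : Triangulation Ω) (k : ℕ) :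
    Submodule ℝ ((𝒯.triangles → Fin 2 → MvPolynomial.restrictTotalDegree (Fin 2) ℝ k)
      × L2Vec Ω) where
  carrier := {z | ∀ t : 𝒯.triangles, ∀ i : Fin 2, ∀ᵐ x ∂(volume.restrict Ω),
    x ∈ convexHull ℝ ((t : Finset Plane) : Set Plane) →
      z.2 x i = MvPolynomial.eval (fun j ↦ x j) (z.1 t i : MvPolynomial (Fin 2) ℝ)}
  zero_mem' := by
    intro t i
    filter_upwards [Lp.coeFn_zero Plane 2 (volume.restrict Ω)] with x hx _
    simpa using congrArg (fun v : Plane ↦ v i) hx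
  add_mem' := by
    intro z w hz hw t i
    filter_upwards [Lp.coeFn_add z.2 w.2, hz t i, hw t i] with x hx h1 h2 hxt
    have h3 : (z.2 + w.2 : L2Vec Ω) x i = z.2 x i + w.2 x i := congrArg (fun v : Plane ↦ v i) hx
    change (z.2 + w.2 : L2Vec Ω) x i = _
    rw [h3, h1 hxt, h2 hxt]
    simp
  smul_mem' := by
    intro c z hz t i
    filter_upwards [Lp.coeFn_smul c z.2, hz t i] with x hx h1 hxt
    simp [hx, h1 hxt, MvPolynomial.smul_eval]

/-- `X_h(𝒯)` is finite-dimensional, so that the `L²` projection onto it is defined. -/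
instance finiteDimensional_Xh {Ω : Set Plane} (𝒯 : Triangulation Ω) (k : ℕ) :
    FiniteDimensional ℝ (Xh 𝒯 k) := by
  have : Finite 𝒯.triangles := 𝒯.finite
  have : Countable 𝒯.triangles := Finite.to_countable
  have hcl : ∀ᵐ x ∂(volume.restrict Ω), x ∈ closure Ω := by
    have h := ae_restrict_mem₀ (μ := (volume : Measure Plane)) (s := closure Ω)
      isClosed_closure.measurableSet.nullMeasurableSet
    exact ae_mono (Measure.restrict_mono subset_closure le_rfl) h
  have hinj : Function.Injective
      ((LinearMap.fst ℝ _ (L2Vec Ω)).comp (polyGraph 𝒯 k).subtype) := by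
    refine (injective_iff_map_eq_zero _).2 ?_
    rintro ⟨⟨P, q⟩, hz⟩ h0
    have hP : P = 0 := by simpa using h0
    subst hP
    have hq : q = 0 := by
      refine Lp.eq_zero_iff_ae_eq_zero.2 ?_
      have hz' := ae_all_iff.2 fun t ↦ ae_all_iff.2 fun i ↦ hz t i
      filter_upwards [hz', hcl] with x hx hxc
      rw [← 𝒯.cover, Set.mem_iUnion₂] at hxc
      obtain ⟨t, ht, hxt⟩ := hxc
      ext i
      simpa using hx ⟨t, ht⟩ i hxt
    subst hq
    rfl
  have : FiniteDimensional ℝ (polyGraph 𝒯 k) := FiniteDimensional.of_injective _ hinj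
  have hle : Xh 𝒯 k ≤ (polyGraph 𝒯 k).map (LinearMap.snd ℝ _ (L2Vec Ω)) := by
    intro q hq
    have hq' : ∀ (t : 𝒯.triangles) (i : Fin 2), ∃ p : MvPolynomial (Fin 2) ℝ,
        p.totalDegree ≤ k ∧ ∀ᵐ x ∂(volume.restrict Ω),
          x ∈ convexHull ℝ ((t : Finset Plane) : Set Plane) →
            q x i = MvPolynomial.eval (fun j ↦ x j) p := fun t i ↦ hq i t t.2
    choose p hp hpq using hq'
    exact ⟨(fun t i ↦ ⟨p t i, (MvPolynomial.mem_restrictTotalDegree _ _ _).2 (hp t i)⟩, q),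
      fun t i ↦ hpq t i, rfl⟩
  exact Submodule.finiteDimensional_of_le hle

/-- The `L²` projection `Π_{X_h(𝒯)} : L²(Ω; ℝ²) → X_h(𝒯) ⊆ L²(Ω; ℝ²)`. -/
def projXh {Ω : Set Plane} (𝒯 : Triangulation Ω) (k : ℕ) : L2Vec Ω →L[ℝ] L2Vec Ω :=
  (Xh 𝒯 k).starProjection

end

end DiscGrad

/-!
The inclusion `Π ∇H¹₀(Ω) ⊆ W_h` holds because the Curl of a function in `Y_h` is again a piecewise
polynomial field of degree `k` and is orthogonal to all gradients of test functions, as second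
derivatives commute (`HasWeakCurl.mem_Xh`, `HasWeakCurl.inner_gradH1Zero_eq_zero`).

For the converse, the projections of gradients of test functions form a subspace of the
finite-dimensional space `X_h`, so it suffices that every `x ∈ X_h` orthogonal to this subspace is
orthogonal to `W_h` (`Wh_subset_map_testGradients`). Such an `x` is orthogonal to all gradients of
test functions, hence divergence-free in the sense of distributions, and the point is that then
`x = Curl β` with `β ∈ Y_h` (`exists_mem_Yh_hasWeakCurl`).

The function `β` comes from a Poincaré lemma for bounded, weakly closed `1`-forms on simply
connected open sets (`IsWeaklyClosed.exists_isWeakPrimitive`). Near a point, the mollified forms are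
smooth and closed; their primitives are equi-Lipschitz, and a limit given by the Arzelà–Ascoli
theorem is a continuous weak primitive (`exists_isWeakPrimitive_ball`). Two continuous local
primitives differ by a locally constant function, so the local primitives define a covering space of
the domain with discrete fibre `ℝ`, and simple connectedness gives a global section of it
(`exists_forall_eventually_sub_eq`). On each triangle the form is polynomial and closed, hence
has a polynomial primitive by Euler's identity (`exists_forall_pderiv_eq`), and `β` differs from it
by a constant. The Lipschitz boundary enters only in ensuring that the interiors of the triangles
lie in `Ω`, i.e. that `Ω` has no slits.

A refined triangulation has a larger space `X_h`, so that projecting first onto it and then onto the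
coarse space is the same as projecting directly; this turns the first identity, on both
triangulations, into the second one.
-/

namespace DiscGrad

open MeasureTheory Filter Topology
open scoped ContDiff Convolution Manifold

/-! ### Gluing local functions on simply connected spaces -/

/-- On a simply connected, locally path connected space, functions `f i` on the members `U i` of an
open cover that differ by locally constant functions on the overlaps can be glued, up to locally
constant functions on each `U i`. The values `f i x + a` form a covering space with fibre `A`, and
simple connectedness provides a global section of it. -/
theorem exists_forall_eventually_sub_eq {X A ι : Type*} [TopologicalSpace X]
    [SimplyConnectedSpace X] [LocallyPathConnectedSpace X] [AddCommGroup A]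
    (U : ι → Set X) (hU : ∀ i, IsOpen (U i)) (hcov : ∀ x, ∃ i, x ∈ U i) (f : ι → X → A)
    (hf : ∀ i j, ∀ x ∈ U i ∩ U j, ∀ᶠ y in 𝓝 x, f i y - f j y = f i x - f j x) :
    ∃ F : X → A, ∀ i, ∀ x ∈ U i, ∀ᶠ y in 𝓝 x, F y - f i y = F x - f i x := by
  let _ : TopologicalSpace A := ⊥
  have : DiscreteTopology A := ⟨rfl⟩
  choose idx hidx using hcov
  let Z : FiberBundleCore ι X A :=
    { baseSet := U
      isOpen_baseSet := hU
      indexAt := idx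
      mem_baseSet_at := hidx
      coordChange := fun i j x v ↦ v + (f i x - f j x)
      coordChange_self := fun i x _ v ↦ by simp
      continuousOn_coordChange := by
        rintro i j ⟨x, v⟩ ⟨hx, -⟩
        refine ContinuousAt.continuousWithinAt ?_
        have h : ∀ᶠ p : X × A in 𝓝 (x, v), p.2 + (f i p.1 - f j p.1) = p.2 + (f i x - f j x) := by
          filter_upwards [continuous_fst.continuousAt.eventually (hf i j x hx)] with p hp
          rw [hp]
        refine ContinuousAt.congr_of_eventuallyEq ?_ h
        exact (continuous_of_discreteTopology
          (f := fun a : A ↦ a + (f i x - f j x))).continuousAt.comp continuousAt_snd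
      coordChange_comp := fun i j k x _ v ↦ by abel }
  have cov : IsCoveringMap (Bundle.TotalSpace.proj : Bundle.TotalSpace A Z.Fiber → X) :=
    FiberBundle.isCoveringMap
  obtain ⟨x₀⟩ : Nonempty X := inferInstance
  obtain ⟨s, ⟨-, hs⟩, -⟩ := cov.existsUnique_continuousMap_lifts (ContinuousMap.id X) x₀
    (⟨x₀, (0 : A)⟩ : Bundle.TotalSpace A Z.Fiber) rfl
  have hproj : ∀ x, (s x).proj = x := fun x ↦ congrFun hs x
  refine ⟨fun x ↦ (show A from (s x).2) + f (idx (s x).1) x, fun i x hx ↦ ?_⟩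
  have hc : ContinuousAt (fun y ↦ (Z.localTriv i (s y)).2) x := by
    have hmem : s x ∈ (Z.localTriv i).source := by
      rw [(Z.localTriv i).mem_source]
      change (s x).proj ∈ U i
      rwa [hproj x]
    exact continuous_snd.continuousAt.comp
      (((Z.localTriv i).continuousAt hmem).comp s.continuous.continuousAt)
  -- The fibre coordinate of the section is continuous with values in a discrete space.
  have hd := (hc.tendsto.eventually (IsOpen.mem_nhds (isOpen_discrete {(Z.localTriv i (s x)).2})
    rfl))
  have hval : ∀ y, (Z.localTriv i (s y)).2 =
      (show A from (s y).2) + (f (idx (s y).1) (s y).1 - f i (s y).1) := fun y ↦ rfl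
  filter_upwards [hd] with y hy
  have hy' : (Z.localTriv i (s y)).2 = (Z.localTriv i (s x)).2 := hy
  rw [hval, hval, hproj x, hproj y] at hy'
  rw [hproj x, hproj y, add_sub_assoc, add_sub_assoc]
  exact hy'

/-! ### Test functions -/

theorem IsTestFunction.mono {U V : Set Plane} {φ : Plane → ℝ} (h : IsTestFunction U φ)
    (hUV : U ⊆ V) : IsTestFunction V φ :=
  ⟨h.smooth, h.compact, h.support.trans hUV⟩

theorem IsTestFunction.continuous {U : Set Plane} {φ : Plane → ℝ} (h : IsTestFunction U φ) :
    Continuous φ := h.smooth.continuous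

theorem IsTestFunction.continuous_fderiv {U : Set Plane} {φ : Plane → ℝ}
    (h : IsTestFunction U φ) : Continuous (fderiv ℝ φ) :=
  h.smooth.continuous_fderiv (by simp)

theorem IsTestFunction.continuous_fderiv_apply {U : Set Plane} {φ : Plane → ℝ}
    (h : IsTestFunction U φ) (v : Plane) : Continuous (fun x ↦ fderiv ℝ φ x v) :=
  h.continuous_fderiv.clm_apply continuous_const

theorem IsTestFunction.hasCompactSupport_fderiv_apply {U : Set Plane} {φ : Plane → ℝ}
    (h : IsTestFunction U φ) (v : Plane) : HasCompactSupport (fun x ↦ fderiv ℝ φ x v) :=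
  h.compact.fderiv_apply ℝ v

theorem IsTestFunction.eq_zero {U : Set Plane} {φ : Plane → ℝ} (h : IsTestFunction U φ)
    {x : Plane} (hx : x ∉ U) : φ x = 0 :=
  image_eq_zero_of_notMem_tsupport fun h' ↦ hx (h.support h')

theorem fderiv_apply_eq_zero_of_notMem_tsupport {φ : Plane → ℝ} {x : Plane}
    (hx : x ∉ tsupport φ) (v : Plane) : fderiv ℝ φ x v = 0 := by
  have : fderiv ℝ φ x = 0 :=
    image_eq_zero_of_notMem_tsupport fun h' ↦ hx (tsupport_fderiv_subset ℝ h')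
  simp [this]

theorem IsTestFunction.fderiv_apply_eq_zero {U : Set Plane} {φ : Plane → ℝ}
    (h : IsTestFunction U φ) {x : Plane} (hx : x ∉ U) (v : Plane) : fderiv ℝ φ x v = 0 :=
  fderiv_apply_eq_zero_of_notMem_tsupport (fun h' ↦ hx (h.support h')) v

/-- A function continuous on `U`, multiplied by a continuous function whose compact support lies in
`U`, is integrable on the plane. -/
theorem integrable_mul_of_continuousOn {U : Set Plane} {f ψ : Plane → ℝ} (hf : ContinuousOn f U)
    (hψ : Continuous ψ) (hc : HasCompactSupport ψ) (hs : tsupport ψ ⊆ U) :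
    Integrable (fun x ↦ f x * ψ x) := by
  have h1 : IntegrableOn (fun x ↦ f x * ψ x) (tsupport ψ) :=
    ((hf.mono hs).mul hψ.continuousOn).integrableOn_compact hc
  refine (integrableOn_iff_integrable_of_support_subset ?_).1 h1
  exact (Function.support_mul_subset_right f ψ).trans (subset_tsupport ψ)

/-! ### Weak primitives and weakly closed forms -/

/-- `f` is a weak primitive on `U` of the `1`-form `η`, i.e. `df = η` in the sense of distributions
on `U`. The integrals extend over the plane, the test functions being supported in `U`. -/
def IsWeakPrimitive (U : Set Plane) (f : Plane → ℝ) (η : Plane → Plane →L[ℝ] ℝ) : Prop :=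
  ∀ φ, IsTestFunction U φ → ∀ v, ∫ x, f x * fderiv ℝ φ x v = - ∫ x, φ x * η x v

/-- The `1`-form `η` is weakly closed on `U`, i.e. `dη = 0` in the sense of distributions on
`U`. -/
def IsWeaklyClosed (U : Set Plane) (η : Plane → Plane →L[ℝ] ℝ) : Prop :=
  ∀ φ, IsTestFunction U φ → ∀ v w,
    ∫ x, fderiv ℝ φ x v * η x w = ∫ x, fderiv ℝ φ x w * η x v

theorem IsWeakPrimitive.mono {U V : Set Plane} {f : Plane → ℝ} {η : Plane → Plane →L[ℝ] ℝ}
    (h : IsWeakPrimitive V f η) (hUV : U ⊆ V) : IsWeakPrimitive U f η :=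
  fun φ hφ ↦ h φ (hφ.mono hUV)

theorem isWeakPrimitive_of_hasFDerivAt {U : Set Plane} {f : Plane → ℝ} {η : Plane → Plane →L[ℝ] ℝ}
    (hf : ∀ x ∈ U, HasFDerivAt f (η x) x) (hη : ContinuousOn η U) : IsWeakPrimitive U f η := by
  intro φ hφ v
  have hfc : ContinuousOn f U := fun x hx ↦ (hf x hx).continuousAt.continuousWithinAt
  have hηv : ContinuousOn (fun x ↦ η x v) U := hη.clm_apply continuousOn_const
  have hts : tsupport (fun x ↦ fderiv ℝ φ x v) ⊆ U :=
    (tsupport_fderiv_apply_subset ℝ v).trans hφ.support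
  have hid : ∀ x, fderiv ℝ f x v * φ x = η x v * φ x := fun x ↦ by
    by_cases hx : x ∈ U
    · rw [(hf x hx).fderiv]
    · rw [hφ.eq_zero hx, mul_zero, mul_zero]
  have h := integral_mul_fderiv_eq_neg_fderiv_mul_of_integrable (μ := volume) (f := f) (g := φ)
    (v := v) ?_ ?_ ?_ (fun x hx ↦ (hf x (hφ.support hx)).differentiableAt)
    (fun x _ ↦ hφ.smooth.differentiable (by simp) x)
  · rw [h]
    simp_rw [hid, mul_comm (φ _)]
  · simp_rw [hid]
    exact integrable_mul_of_continuousOn hηv hφ.continuous hφ.compact hφ.support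
  · exact integrable_mul_of_continuousOn hfc (hφ.continuous_fderiv_apply v)
      (hφ.hasCompactSupport_fderiv_apply v) hts
  · exact integrable_mul_of_continuousOn hfc hφ.continuous hφ.compact hφ.support

/-! ### Mollification -/

/-- A sequence of bump functions at the origin, supported in the balls of radius `1 / (n + 1)`. -/
noncomputable def shrinkingBump (n : ℕ) : ContDiffBump (0 : Plane) where
  rIn := 1 / (2 * (n + 1))
  rOut := 1 / (n + 1)
  rIn_pos := by positivity
  rIn_lt_rOut := by
    have : (0 : ℝ) < n + 1 := by positivity
    gcongr
    linarith

theorem tendsto_shrinkingBump_rOut :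
    Tendsto (fun n ↦ (shrinkingBump n).rOut) atTop (𝓝 0) :=
  tendsto_one_div_add_atTop_nhds_zero_nat

section Mollify

variable {E : Type*} [NormedAddCommGroup E] [NormedSpace ℝ E]

/-- The `n`-th mollification of `g`. -/
noncomputable def mollify (n : ℕ) (g : Plane → E) : Plane → E :=
  (shrinkingBump n).normed volume ⋆[ContinuousLinearMap.lsmul ℝ ℝ, volume] g

/-- The kernel `y ↦ ρ (x - y)` of the mollification at `x`. -/
noncomputable def mollifyKernel (n : ℕ) (x y : Plane) : ℝ := (shrinkingBump n).normed volume (x - y)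

theorem mollify_apply (n : ℕ) (g : Plane → E) (x : Plane) :
    mollify n g x = ∫ y, mollifyKernel n x y • g y :=
  convolution_lsmul_swap

theorem isTestFunction_mollifyKernel {U : Set Plane} {n : ℕ} {x : Plane}
    (h : Metric.closedBall x (shrinkingBump n).rOut ⊆ U) :
    IsTestFunction U (mollifyKernel n x) := by
  have hsupp : tsupport (mollifyKernel n x) ⊆ Metric.closedBall x (shrinkingBump n).rOut := by
    refine closure_minimal ?_ Metric.isClosed_closedBall
    intro y hy
    have h1 : x - y ∈ Function.support ((shrinkingBump n).normed volume) := hy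
    rw [ContDiffBump.support_normed_eq] at h1
    rw [Metric.mem_closedBall, dist_comm, dist_eq_norm]
    exact (mem_ball_zero_iff.1 h1).le
  exact ⟨((shrinkingBump n).contDiff_normed (μ := volume)).comp (contDiff_const.sub contDiff_id),
    HasCompactSupport.of_support_subset_isCompact (isCompact_closedBall _ _)
      ((subset_tsupport _).trans hsupp), hsupp.trans h⟩

theorem integral_mollifyKernel (n : ℕ) (x : Plane) : ∫ y, mollifyKernel n x y = 1 := by
  unfold mollifyKernel
  rw [integral_sub_left_eq_self (fun y ↦ (shrinkingBump n).normed volume y) volume x]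
  exact (shrinkingBump n).integral_normed

theorem fderiv_mollifyKernel (n : ℕ) (x y v : Plane) :
    fderiv ℝ (mollifyKernel n x) y v = -fderiv ℝ ((shrinkingBump n).normed volume) (x - y) v := by
  have h1 : DifferentiableAt ℝ ((shrinkingBump n).normed volume) (x - y) :=
    ((shrinkingBump n).contDiff_normed (μ := volume) (n := 1)).differentiable (by simp) _
  have h2 : HasFDerivAt (fun y : Plane ↦ x - y) (-ContinuousLinearMap.id ℝ Plane) y :=
    (hasFDerivAt_id y).const_sub x
  have h3 := h1.hasFDerivAt.comp y h2
  have h4 : HasFDerivAt (mollifyKernel n x) _ y := h3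
  rw [h4.fderiv]
  simp

theorem differentiable_mollify [CompleteSpace E] (n : ℕ) {g : Plane → E}
    (hg : LocallyIntegrable g) : Differentiable ℝ (mollify n g) := fun x ↦
  ((shrinkingBump n).hasCompactSupport_normed.hasFDerivAt_convolution_left
    (ContinuousLinearMap.lsmul ℝ ℝ) (shrinkingBump n).contDiff_normed hg x).differentiableAt

/-- The derivative of a mollification is obtained by differentiating the kernel. -/
theorem fderiv_mollify [CompleteSpace E] (n : ℕ) {g : Plane → E} (hg : LocallyIntegrable g)
    (x v : Plane) :
    fderiv ℝ (mollify n g) x v = - ∫ y, fderiv ℝ (mollifyKernel n x) y v • g y := by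
  have h := (shrinkingBump n).hasCompactSupport_normed (μ := volume)
    |>.hasFDerivAt_convolution_left (ContinuousLinearMap.lsmul ℝ ℝ)
    (shrinkingBump n).contDiff_normed hg x
  have hfd : fderiv ℝ (mollify n g) x = _ := h.fderiv
  have hex := ((shrinkingBump n).hasCompactSupport_normed (μ := volume)).fderiv ℝ
    |>.convolutionExists_left ((ContinuousLinearMap.lsmul ℝ ℝ).precompL Plane (E := ℝ) (Fₗ := E))
    (((shrinkingBump n).contDiff_normed (μ := volume) (n := 1)).continuous_fderiv (by simp)) hg x
  rw [hfd, convolution_def, ContinuousLinearMap.integral_apply hex]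
  simp_rw [ContinuousLinearMap.precompL_apply, ContinuousLinearMap.lsmul_apply]
  rw [← integral_neg, ← integral_sub_left_eq_self _ volume x]
  refine integral_congr_ae (Eventually.of_forall fun y ↦ ?_)
  simp only [sub_sub_cancel, fderiv_mollifyKernel, neg_smul, neg_neg]

end Mollify

/-! ### Functions with vanishing weak derivative -/

/-- A continuous function with vanishing weak derivative is locally constant: its mollifications
are. -/
theorem eventually_eq_of_isWeakPrimitive_zero {U : Set Plane} (hU : IsOpen U) {f : Plane → ℝ}
    (hf : ContinuousOn f U) (h : IsWeakPrimitive U f 0) {x : Plane} (hx : x ∈ U) :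
    ∀ᶠ y in 𝓝 x, f y = f x := by
  obtain ⟨r, hr, hrU⟩ := Metric.nhds_basis_closedBall.mem_iff.1 (hU.mem_nhds hx)
  set g : Plane → ℝ := (Metric.closedBall x r).indicator f with hg
  have hgi : Integrable g := by
    rw [hg, integrable_indicator_iff Metric.isClosed_closedBall.measurableSet]
    exact (hf.mono hrU).integrableOn_compact (isCompact_closedBall x r)
  have hgl := hgi.locallyIntegrable
  have hgc : ∀ y ∈ Metric.ball x (r / 2), Tendsto (fun n ↦ mollify n g y) atTop (𝓝 (f y)) := by
    intro y hy
    have hyr : y ∈ Metric.ball x r := Metric.ball_subset_ball (by linarith) hy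
    have hev : g =ᶠ[𝓝 y] f := by
      filter_upwards [Metric.isOpen_ball.mem_nhds hyr] with z hz
      exact Set.indicator_of_mem (Metric.ball_subset_closedBall hz) f
    have hcont : Tendsto g (𝓝 y) (𝓝 (f y)) :=
      (hf.continuousAt (hU.mem_nhds (hrU (Metric.ball_subset_closedBall hyr)))).tendsto.congr'
        hev.symm
    exact ContDiffBump.convolution_tendsto_right (g := fun _ ↦ g) tendsto_shrinkingBump_rOut
      (Eventually.of_forall fun _ ↦ hgi.aestronglyMeasurable) (hcont.comp tendsto_snd)
      tendsto_const_nhds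
  have hconst : ∀ᶠ n in atTop, ∀ y ∈ Metric.ball x (r / 2), mollify n g y = mollify n g x := by
    filter_upwards [tendsto_shrinkingBump_rOut.eventually (gt_mem_nhds (half_pos hr))] with n hn
    intro y hy
    refine (convex_ball x (r / 2)).is_const_of_fderivWithin_eq_zero (𝕜 := ℝ)
      (differentiable_mollify n hgl).differentiableOn (fun z hz ↦ ?_) hy
      (Metric.mem_ball_self (half_pos hr))
    rw [fderivWithin_of_isOpen Metric.isOpen_ball hz]
    ext v
    have htest : IsTestFunction (Metric.closedBall x r) (mollifyKernel n z) := by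
      refine isTestFunction_mollifyKernel (Metric.closedBall_subset_closedBall' ?_)
      have := Metric.mem_ball.1 hz
      linarith
    rw [fderiv_mollify n hgl]
    have h0 := h _ (htest.mono hrU) v
    have hcongr : ∀ y, fderiv ℝ (mollifyKernel n z) y v • g y =
        f y * fderiv ℝ (mollifyKernel n z) y v := by
      intro y
      by_cases hy : y ∈ Metric.closedBall x r
      · rw [hg, Set.indicator_of_mem hy, smul_eq_mul, mul_comm]
      · rw [htest.fderiv_apply_eq_zero hy, zero_smul, mul_zero]
    simp_rw [hcongr, h0]
    simp
  filter_upwards [Metric.ball_mem_nhds x (half_pos hr)] with y hy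
  refine tendsto_nhds_unique (hgc y hy) ?_
  refine (hgc x (Metric.mem_ball_self (half_pos hr))).congr' ?_
  filter_upwards [hconst] with n hn
  exact (hn y hy).symm

/-- The difference of two continuous weak primitives of the same form is locally constant. -/
theorem eventually_sub_eq_of_isWeakPrimitive {U : Set Plane} (hU : IsOpen U) {f g : Plane → ℝ}
    {η : Plane → Plane →L[ℝ] ℝ} (hf : ContinuousOn f U) (hg : ContinuousOn g U)
    (hfη : IsWeakPrimitive U f η) (hgη : IsWeakPrimitive U g η) {x : Plane} (hx : x ∈ U) :
    ∀ᶠ y in 𝓝 x, f y - g y = f x - g x := by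
  refine eventually_eq_of_isWeakPrimitive_zero hU (f := fun y ↦ f y - g y) (hf.sub hg) ?_ hx
  intro φ hφ v
  have hts : tsupport (fun x ↦ fderiv ℝ φ x v) ⊆ U :=
    (tsupport_fderiv_apply_subset ℝ v).trans hφ.support
  simp_rw [sub_mul]
  rw [integral_sub
    (integrable_mul_of_continuousOn hf (hφ.continuous_fderiv_apply v)
      (hφ.hasCompactSupport_fderiv_apply v) hts)
    (integrable_mul_of_continuousOn hg (hφ.continuous_fderiv_apply v)
      (hφ.hasCompactSupport_fderiv_apply v) hts), hfη φ hφ v, hgη φ hφ v]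
  simp

/-- On a connected set, two continuous weak primitives of the same form differ by a constant. -/
theorem exists_eq_add_of_isWeakPrimitive {U : Set Plane} (hU : IsOpen U) (hUc : IsPreconnected U)
    {f g : Plane → ℝ} {η : Plane → Plane →L[ℝ] ℝ} (hf : ContinuousOn f U) (hg : ContinuousOn g U)
    (hfη : IsWeakPrimitive U f η) (hgη : IsWeakPrimitive U g η) :
    ∃ c, ∀ x ∈ U, f x = g x + c := by
  rcases U.eq_empty_or_nonempty with rfl | ⟨x₀, hx₀⟩
  · exact ⟨0, by simp⟩
  have : PreconnectedSpace U := isPreconnected_iff_preconnectedSpace.1 hUc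
  have hl : IsLocallyConstant (fun x : U ↦ f x - g x) := by
    rw [IsLocallyConstant.iff_eventually_eq]
    intro x
    exact continuous_subtype_val.continuousAt.eventually
      (eventually_sub_eq_of_isWeakPrimitive hU hf hg hfη hgη x.2)
  refine ⟨f x₀ - g x₀, fun x hx ↦ ?_⟩
  have := hl.apply_eq_of_preconnectedSpace ⟨x, hx⟩ ⟨x₀, hx₀⟩
  simp only at this
  linarith

/-! ### The Poincaré lemma for weakly closed bounded forms -/

section Poincare

variable {η : Plane → Plane →L[ℝ] ℝ} {M : ℝ}

theorem norm_mollify_le (n : ℕ) (hM : ∀ᵐ x, ‖η x‖ ≤ M) (x : Plane) : ‖mollify n η x‖ ≤ M := by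
  have htest : IsTestFunction Set.univ (mollifyKernel n x) :=
    isTestFunction_mollifyKernel (Set.subset_univ _)
  rw [mollify_apply]
  calc ‖∫ y, mollifyKernel n x y • η y‖ ≤ ∫ y, mollifyKernel n x y * M := by
        refine norm_integral_le_of_norm_le
          ((htest.continuous.integrable_of_hasCompactSupport htest.compact).mul_const M)
          ?_
        filter_upwards [hM] with y hy
        have h0 : 0 ≤ mollifyKernel n x y := (shrinkingBump n).nonneg_normed _
        rw [norm_smul, Real.norm_of_nonneg h0]
        gcongr
    _ = M := by rw [integral_mul_const, integral_mollifyKernel, one_mul]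

/-- The mollifications of a weakly closed form are closed. -/
theorem fderiv_mollify_symm {U : Set Plane} (hη : LocallyIntegrable η) (h : IsWeaklyClosed U η)
    (n : ℕ) {x : Plane} (hx : Metric.closedBall x (shrinkingBump n).rOut ⊆ U) (v w : Plane) :
    fderiv ℝ (mollify n η) x v w = fderiv ℝ (mollify n η) x w v := by
  have htest : IsTestFunction U (mollifyKernel n x) := isTestFunction_mollifyKernel hx
  have hint : ∀ v, Integrable (fun y ↦ fderiv ℝ (mollifyKernel n x) y v • η y) := fun v ↦
    hη.integrable_smul_left_of_hasCompactSupport (htest.continuous_fderiv_apply v)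
      (htest.hasCompactSupport_fderiv_apply v)
  rw [fderiv_mollify n hη, fderiv_mollify n hη, neg_apply,
    neg_apply, ContinuousLinearMap.integral_apply (hint v),
    ContinuousLinearMap.integral_apply (hint w)]
  congr 1
  simpa using h _ htest v w

theorem locallyIntegrable_of_norm_le (hηm : AEStronglyMeasurable η) (hM : ∀ᵐ x, ‖η x‖ ≤ M) :
    LocallyIntegrable η :=
  (MeasureTheory.locallyIntegrable_const M).mono hηm
    (hM.mono fun _ hx ↦ hx.trans (le_abs_self M))

/-- A primitive of a mollification of `η`, on a ball, normalised to vanish at the centre. -/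
theorem exists_primitive_mollify {x₀ : Plane} {r : ℝ}
    (hηm : AEStronglyMeasurable η) (hM : ∀ᵐ x, ‖η x‖ ≤ M)
    (h : IsWeaklyClosed (Metric.ball x₀ (3 * r)) η) (n : ℕ) (hn : (shrinkingBump n).rOut < r) :
    ∃ f : Plane → ℝ, f x₀ = 0 ∧
      ∀ x ∈ Metric.ball x₀ (2 * r), HasFDerivAt f (mollify n η x) x := by
  have hηl := locallyIntegrable_of_norm_le hηm hM
  obtain ⟨f, hf⟩ := (convex_ball x₀ (2 * r)).exists_forall_hasFDerivAt_of_fderiv_symmetric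
    Metric.isOpen_ball (differentiable_mollify n hηl).differentiableOn (fun x hx v w ↦ by
      refine fderiv_mollify_symm hηl h n (fun y hy ↦ ?_) v w
      rw [Metric.mem_ball] at hx ⊢
      rw [Metric.mem_closedBall] at hy
      linarith [dist_triangle y x x₀])
  exact ⟨fun x ↦ f x - f x₀, sub_self _, fun x hx ↦ (hf x hx).sub_const _⟩

/-- The local Poincaré lemma: a bounded weakly closed form has a continuous weak primitive near
every point. The primitives of the mollifications are equi-Lipschitz, so that a subsequence
converges uniformly by the Arzelà–Ascoli theorem. -/
theorem exists_isWeakPrimitive_ball {x₀ : Plane} {r : ℝ} (hr : 0 < r)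
    (hηm : AEStronglyMeasurable η) (hM : ∀ᵐ x, ‖η x‖ ≤ M)
    (h : IsWeaklyClosed (Metric.ball x₀ (3 * r)) η) :
    ∃ f : Plane → ℝ, ContinuousOn f (Metric.ball x₀ r) ∧
      IsWeakPrimitive (Metric.ball x₀ r) f η := by
  have hηl := locallyIntegrable_of_norm_le hηm hM
  have hM0 : 0 ≤ M := (norm_nonneg _).trans hM.exists.choose_spec
  -- Only mollifications at a scale below `r` are closed on the ball of radius `2 * r`.
  obtain ⟨N, hN⟩ := eventually_atTop.1 (tendsto_shrinkingBump_rOut.eventually (gt_mem_nhds hr))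
  choose F hF0 hF using fun n ↦
    exists_primitive_mollify hηm hM h (n + N) (hN (n + N) (Nat.le_add_left N n))
  let K := Metric.closedBall x₀ r
  have hK2 : K ⊆ Metric.ball x₀ (2 * r) := Metric.closedBall_subset_ball (by linarith)
  have hK : IsCompact K := isCompact_closedBall x₀ r
  have : CompactSpace K := isCompact_iff_compactSpace.1 hK
  have hx₀ : x₀ ∈ K := Metric.mem_closedBall_self hr.le
  have hlip : ∀ n, ∀ x ∈ K, ∀ y ∈ K, ‖F n y - F n x‖ ≤ M * ‖y - x‖ := fun n x hx y hy ↦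
    (convex_closedBall x₀ r).norm_image_sub_le_of_norm_hasFDerivWithin_le
      (fun z hz ↦ (hF n z (hK2 hz)).hasFDerivWithinAt) (fun z _ ↦ norm_mollify_le _ hM z) hx hy
  have hlip' : ∀ n, LipschitzWith ⟨M, hM0⟩ (fun x : K ↦ F n x) := fun n ↦
    LipschitzWith.of_dist_le_mul fun x y ↦ by
      rw [Subtype.dist_eq, dist_eq_norm, dist_eq_norm]
      exact hlip n y y.2 x x.2
  have hbd : ∀ n, ∀ x ∈ K, ‖F n x‖ ≤ M * r := fun n x hx ↦ by
    have h1 := hlip n x₀ hx₀ x hx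
    rw [hF0, sub_zero] at h1
    refine h1.trans ?_
    gcongr
    exact mem_closedBall_iff_norm.1 hx
  let G : ℕ → BoundedContinuousFunction K ℝ := fun n ↦
    BoundedContinuousFunction.mkOfCompact ⟨fun x : K ↦ F n x, (hlip' n).continuous⟩
  have hcomp : IsCompact (closure (Set.range G)) := by
    refine BoundedContinuousFunction.arzela_ascoli (Metric.closedBall 0 (M * r))
      (isCompact_closedBall _ _) _ ?_ ?_
    · rintro _ x ⟨n, rfl⟩
      rw [mem_closedBall_zero_iff]
      exact hbd n x x.2
    · refine UniformEquicontinuous.equicontinuous (LipschitzWith.uniformEquicontinuous _ ⟨M, hM0⟩ ?_)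
      rintro ⟨_, n, rfl⟩
      exact hlip' n
  obtain ⟨g, -, s, hs, hg⟩ := hcomp.tendsto_subseq fun n ↦ subset_closure (Set.mem_range_self n)
  classical
  let f : Plane → ℝ := fun x ↦ if hx : x ∈ K then g ⟨x, hx⟩ else 0
  have hfK : ContinuousOn f K := by
    rw [continuousOn_iff_continuous_domRestrict]
    have : K.domRestrict f = g := by
      ext x
      simp [f, Set.domRestrict_apply]
    rw [this]
    exact g.continuous
  have hlim : ∀ x ∈ K, Tendsto (fun n ↦ F (s n) x) atTop (𝓝 (f x)) := fun x hx ↦ by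
    have := ((continuous_eval_const (⟨x, hx⟩ : K)).tendsto g).comp hg
    have hfx : f x = g ⟨x, hx⟩ := dif_pos hx
    rw [hfx]
    exact this
  have hBK : Metric.ball x₀ r ⊆ K := Metric.ball_subset_closedBall
  refine ⟨f, hfK.mono hBK, fun φ hφ v ↦ ?_⟩
  have hs' : Tendsto (fun n ↦ s n + N) atTop atTop :=
    tendsto_atTop_mono (fun n ↦ Nat.le_add_right _ _) hs.tendsto_atTop
  have hleft : Tendsto (fun n ↦ ∫ x, F (s n) x * fderiv ℝ φ x v) atTop
      (𝓝 (∫ x, f x * fderiv ℝ φ x v)) := by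
    refine tendsto_integral_of_dominated_convergence (fun x ↦ M * r * ‖fderiv ℝ φ x v‖) ?_ ?_ ?_ ?_
    · intro n
      refine (integrable_mul_of_continuousOn (U := Metric.ball x₀ r) ?_
        (hφ.continuous_fderiv_apply v) (hφ.hasCompactSupport_fderiv_apply v)
        ((tsupport_fderiv_apply_subset ℝ v).trans hφ.support)).aestronglyMeasurable
      exact fun x hx ↦ (hF (s n) x (hK2 (hBK hx))).continuousAt.continuousWithinAt
    · exact ((hφ.continuous_fderiv_apply v).integrable_of_hasCompactSupport
        (hφ.hasCompactSupport_fderiv_apply v)).norm.const_mul _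
    · refine fun n ↦ Eventually.of_forall fun x ↦ ?_
      by_cases hx : x ∈ Metric.ball x₀ r
      · rw [norm_mul]
        gcongr
        exact hbd _ x (hBK hx)
      · rw [hφ.fderiv_apply_eq_zero hx]
        simp
    · refine Eventually.of_forall fun x ↦ ?_
      by_cases hx : x ∈ Metric.ball x₀ r
      · exact (hlim x (hBK hx)).mul_const _
      · rw [hφ.fderiv_apply_eq_zero hx]
        simp
  have hright : Tendsto (fun n ↦ ∫ x, φ x * mollify (s n + N) η x v) atTop
      (𝓝 (∫ x, φ x * η x v)) := by
    refine tendsto_integral_of_dominated_convergence (fun x ↦ ‖φ x‖ * (M * ‖v‖)) ?_ ?_ ?_ ?_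
    · intro n
      exact (hφ.continuous.mul ((differentiable_mollify _ hηl).continuous.clm_apply
        continuous_const)).aestronglyMeasurable
    · exact (hφ.continuous.integrable_of_hasCompactSupport hφ.compact).norm.mul_const _
    · refine fun n ↦ Eventually.of_forall fun x ↦ ?_
      rw [norm_mul]
      gcongr
      exact ContinuousLinearMap.le_of_opNorm_le _ (norm_mollify_le _ hM x) v
    · have hae := ContDiffBump.ae_convolution_tendsto_right_of_locallyIntegrable (μ := volume)
        (φ := shrinkingBump) (K := 2) tendsto_shrinkingBump_rOut (Eventually.of_forall fun n ↦ by
          change 1 / ((n : ℝ) + 1) ≤ 2 * (1 / (2 * (n + 1)))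
          apply le_of_eq
          field_simp) hηl
      filter_upwards [hae] with x hx
      have := ((ContinuousLinearMap.apply ℝ ℝ v).continuous.tendsto (η x)).comp (hx.comp hs')
      exact this.const_mul (φ x)
  refine tendsto_nhds_unique hleft (hright.neg.congr fun n ↦ ?_)
  refine (isWeakPrimitive_of_hasFDerivAt (U := Metric.ball x₀ r) (f := F (s n))
    (η := mollify (s n + N) η) (fun x hx ↦ hF (s n) x (hK2 (hBK hx)))
    (differentiable_mollify _ hηl).continuous.continuousOn φ hφ v).symm

end Poincare

/-- Being a weak primitive is a local property, by a partition of unity. -/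
theorem isWeakPrimitive_of_forall_exists {Ω : Set Plane} {f : Plane → ℝ}
    {η : Plane → Plane →L[ℝ] ℝ} (hf : ContinuousOn f Ω) (hη : LocallyIntegrable η)
    (h : ∀ x ∈ Ω, ∃ U, IsOpen U ∧ x ∈ U ∧ IsWeakPrimitive U f η) : IsWeakPrimitive Ω f η := by
  intro φ hφ v
  have h' : ∀ x ∈ tsupport φ, ∃ U, IsOpen U ∧ x ∈ U ∧ IsWeakPrimitive U f η :=
    fun x hx ↦ h x (hφ.support hx)
  choose! U hUo hxU hU using h'
  obtain ⟨t, hts, htU⟩ := hφ.compact.elim_nhds_subcover U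
    (fun x hx ↦ (hUo x hx).mem_nhds (hxU x hx))
  obtain ⟨ρ, hρ⟩ := SmoothPartitionOfUnity.exists_isSubordinate 𝓘(ℝ, Plane)
    (isClosed_tsupport φ) (fun i : t ↦ U i) (fun i ↦ hUo i (hts i i.2)) (by
      simpa [Set.iUnion_subtype] using htU)
  let ψ : t → Plane → ℝ := fun i x ↦ ρ i x * φ x
  have hψ : ∀ i : t, IsTestFunction (U i ∩ Ω) (ψ i) := fun i ↦
    { smooth := (ρ i).contMDiff.contDiff.mul hφ.smooth
      compact := hφ.compact.mul_left
      support := Set.subset_inter ((tsupport_mul_subset_left (f := ρ i) (g := φ)).trans (hρ i))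
        ((tsupport_mul_subset_right (f := ρ i) (g := φ)).trans hφ.support) }
  have hsum : ∀ x, φ x = ∑ i, ψ i x := fun x ↦ by
    rw [← Finset.sum_mul]
    by_cases hx : x ∈ tsupport φ
    · have := ρ.sum_eq_one hx
      rw [finsum_eq_sum_of_fintype] at this
      rw [this, one_mul]
    · rw [image_eq_zero_of_notMem_tsupport hx, mul_zero]
  have hsum' : ∀ x, fderiv ℝ φ x v = ∑ i, fderiv ℝ (ψ i) x v := fun x ↦ by
    have : φ = fun x ↦ ∑ i, ψ i x := funext hsum
    rw [this, fderiv_fun_sum fun i _ ↦ (hψ i).smooth.differentiable (by simp) x]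
    simp
  have hηv : LocallyIntegrable fun x ↦ η x v := fun x ↦
    (hη x).imp fun s hs ↦ ⟨hs.1, (ContinuousLinearMap.apply ℝ ℝ v).integrable_comp hs.2⟩
  simp_rw [hsum', hsum, Finset.mul_sum, Finset.sum_mul]
  rw [integral_finsetSum, integral_finsetSum, ← Finset.sum_neg_distrib]
  · exact Finset.sum_congr rfl fun i _ ↦
      hU i (hts i i.2) _ ((hψ i).mono Set.inter_subset_left) v
  · exact fun i _ ↦ hηv.integrable_smul_left_of_hasCompactSupport (hψ i).continuous (hψ i).compact
  · exact fun i _ ↦ integrable_mul_of_continuousOn hf ((hψ i).continuous_fderiv_apply v)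
      ((hψ i).hasCompactSupport_fderiv_apply v) ((tsupport_fderiv_apply_subset ℝ v).trans
        ((hψ i).support.trans Set.inter_subset_right))

/-- The Poincaré lemma: a bounded weakly closed form on a simply connected open set has a
continuous weak primitive. -/
theorem IsWeaklyClosed.exists_isWeakPrimitive {Ω : Set Plane} (hΩ : IsOpen Ω)
    (hsc : IsSimplyConnected Ω) {η : Plane → Plane →L[ℝ] ℝ} {M : ℝ}
    (hηm : AEStronglyMeasurable η) (hM : ∀ᵐ x, ‖η x‖ ≤ M) (h : IsWeaklyClosed Ω η) :
    ∃ f : Plane → ℝ, ContinuousOn f Ω ∧ IsWeakPrimitive Ω f η := by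
  have hloc : ∀ x ∈ Ω, ∃ r > 0, ∃ f : Plane → ℝ, Metric.ball x r ⊆ Ω ∧
      ContinuousOn f (Metric.ball x r) ∧ IsWeakPrimitive (Metric.ball x r) f η := by
    intro x hx
    obtain ⟨R, hR, hRΩ⟩ := Metric.isOpen_iff.1 hΩ x hx
    obtain ⟨f, hf1, hf2⟩ := exists_isWeakPrimitive_ball (x₀ := x) (r := R / 3) (by positivity)
      hηm hM (fun φ hφ ↦ h φ (hφ.mono ((Metric.ball_subset_ball (by linarith)).trans hRΩ)))
    exact ⟨R / 3, by positivity, f, (Metric.ball_subset_ball (by linarith)).trans hRΩ, hf1, hf2⟩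
  choose! r hr f hrΩ hfc hfη using hloc
  have := hsc.simplyConnectedSpace
  have := hΩ.locallyPathConnectedSpace
  let V : Ω → Set Ω := fun x ↦ {y | (y : Plane) ∈ Metric.ball (x : Plane) (r x)}
  let F₀ : Ω → Ω → ℝ := fun x y ↦ f x y
  have hV : ∀ x, IsOpen (V x) := fun x ↦ Metric.isOpen_ball.preimage continuous_subtype_val
  have hxV : ∀ x, ∃ i, x ∈ V i := fun x ↦ ⟨x, Metric.mem_ball_self (hr x x.2)⟩
  have hF₀ : ∀ i j, ∀ x ∈ V i ∩ V j, ∀ᶠ y in 𝓝 x, F₀ i y - F₀ j y = F₀ i x - F₀ j x := by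
    rintro i j x ⟨hi, hj⟩
    have h1 := eventually_sub_eq_of_isWeakPrimitive (Metric.isOpen_ball.inter Metric.isOpen_ball)
      ((hfc i i.2).mono Set.inter_subset_left) ((hfc j j.2).mono Set.inter_subset_right)
      ((hfη i i.2).mono Set.inter_subset_left) ((hfη j j.2).mono Set.inter_subset_right)
      ⟨hi, hj⟩
    exact continuous_subtype_val.continuousAt.eventually h1
  obtain ⟨F, hF⟩ := exists_forall_eventually_sub_eq V hV hxV F₀ hF₀
  classical
  let g : Plane → ℝ := fun x ↦ if hx : x ∈ Ω then F ⟨x, hx⟩ else 0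
  have hg : ∀ x ∈ Ω, ∃ ρ > 0, ∃ c, ρ ≤ r x ∧ ∀ y ∈ Metric.ball x ρ, g y = f x y + c := by
    intro x hx
    have h1 := hF ⟨x, hx⟩ ⟨x, hx⟩ (Metric.mem_ball_self (hr x hx))
    rw [nhds_subtype_eq_comap, eventually_comap, Metric.eventually_nhds_iff_ball] at h1
    obtain ⟨ρ, hρ, h1⟩ := h1
    refine ⟨min ρ (r x), lt_min hρ (hr x hx), F ⟨x, hx⟩ - f x x, min_le_right _ _, fun y hy ↦ ?_⟩
    have hyΩ : y ∈ Ω := hrΩ x hx (Metric.ball_subset_ball (min_le_right _ _) hy)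
    have h2 := h1 y (Metric.ball_subset_ball (min_le_left _ _) hy) ⟨y, hyΩ⟩ rfl
    have h3 : g y = F ⟨y, hyΩ⟩ := dif_pos hyΩ
    have h4 : F ⟨y, hyΩ⟩ - f x y = F ⟨x, hx⟩ - f x x := h2
    rw [h3]
    linarith
  choose! ρ hρ c hρr hgc using hg
  have hball : ∀ x ∈ Ω, Metric.ball x (ρ x) ⊆ Metric.ball x (r x) := fun x hx ↦
    Metric.ball_subset_ball (hρr x hx)
  have hcont : ContinuousOn g Ω := fun x hx ↦ by
    have hmem := Metric.ball_mem_nhds x (hρ x hx)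
    have h1 : ContinuousOn g (Metric.ball x (ρ x)) :=
      (((hfc x hx).mono (hball x hx)).add continuousOn_const).congr (hgc x hx)
    exact (h1.continuousAt hmem).continuousWithinAt
  refine ⟨g, hcont, isWeakPrimitive_of_forall_exists hcont (locallyIntegrable_of_norm_le hηm hM)
    fun x hx ↦ ⟨Metric.ball x (ρ x), Metric.isOpen_ball, Metric.mem_ball_self (hρ x hx), ?_⟩⟩
  intro φ hφ v
  -- The constant `c x` does not contribute, as the derivative of `φ` has integral zero.
  have hconst : ∫ y, c x * fderiv ℝ φ y v = 0 := by
    have := isWeakPrimitive_of_hasFDerivAt (f := fun _ ↦ c x) (η := 0)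
      (fun y _ ↦ hasFDerivAt_const (c x) y) continuousOn_const φ hφ v
    simpa using this
  have hid : ∀ y, g y * fderiv ℝ φ y v = f x y * fderiv ℝ φ y v + c x * fderiv ℝ φ y v := fun y ↦ by
    by_cases hy : y ∈ Metric.ball x (ρ x)
    · rw [hgc x hx y hy, add_mul]
    · rw [hφ.fderiv_apply_eq_zero hy]
      simp
  simp_rw [hid]
  rw [integral_add, hconst, add_zero]
  · exact hfη x hx φ (hφ.mono (hball x hx)) v
  · exact integrable_mul_of_continuousOn (hfc x hx) (hφ.continuous_fderiv_apply v)
      (hφ.hasCompactSupport_fderiv_apply v)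
      ((tsupport_fderiv_apply_subset ℝ v).trans (hφ.support.trans (hball x hx)))
  · exact ((hφ.continuous_fderiv_apply v).integrable_of_hasCompactSupport
      (hφ.hasCompactSupport_fderiv_apply v)).const_mul _

/-! ### Primitives of polynomial fields -/

section Polynomial

open MvPolynomial

variable {σ : Type*}

/-- A linear map between polynomial rings that maps monomials of degree at most `m` to polynomials
of degree at most `n` does so with all polynomials. -/
theorem totalDegree_map_le (L : MvPolynomial σ ℝ →ₗ[ℝ] MvPolynomial σ ℝ) {m n : ℕ}
    (hL : ∀ s a, s.degree ≤ m → (L (monomial s a)).totalDegree ≤ n) {p : MvPolynomial σ ℝ}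
    (hp : p.totalDegree ≤ m) : (L p).totalDegree ≤ n := by
  rw [p.as_sum, map_sum]
  exact totalDegree_finsetSum_le fun s hs ↦ hL s _ ((le_totalDegree hs).trans hp)

theorem totalDegree_pderiv_le (i : σ) {k : ℕ} {p : MvPolynomial σ ℝ}
    (hp : p.totalDegree ≤ k + 1) : (pderiv i p).totalDegree ≤ k := by
  refine totalDegree_map_le (pderiv i).toLinearMap (fun s a hs ↦ ?_) hp
  change (pderiv i (monomial s a)).totalDegree ≤ k
  rw [pderiv_monomial]
  by_cases hsi : s i = 0
  · simp [hsi]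
  · refine (totalDegree_monomial_le _ _).trans ?_
    have h1 : s - Finsupp.single i 1 + Finsupp.single i 1 = s :=
      tsub_add_cancel_of_le (Finsupp.single_le_iff.2 (Nat.one_le_iff_ne_zero.2 hsi))
    have h2 := congrArg Finsupp.degree h1
    rw [map_add, Finsupp.degree_single] at h2
    change (s - Finsupp.single i 1).degree ≤ k
    omega

/-- The linear map multiplying each monomial of degree `d` by `w d`. -/
noncomputable def scaleByDegree (w : ℕ → ℝ) : MvPolynomial σ ℝ →ₗ[ℝ] MvPolynomial σ ℝ :=
  (basisMonomials σ ℝ).constr ℝ fun s ↦ monomial s (w s.degree)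

theorem scaleByDegree_monomial (w : ℕ → ℝ) (s : σ →₀ ℕ) (a : ℝ) :
    scaleByDegree w (monomial s a) = monomial s (a * w s.degree) := by
  have h : monomial s a = a • basisMonomials σ ℝ s := by simp [smul_monomial]
  rw [h, map_smul, scaleByDegree, Module.Basis.constr_basis, smul_monomial, smul_eq_mul]

theorem totalDegree_scaleByDegree_le (w : ℕ → ℝ) {k : ℕ} {p : MvPolynomial σ ℝ}
    (hp : p.totalDegree ≤ k) : (scaleByDegree w p).totalDegree ≤ k := by
  refine totalDegree_map_le _ (fun s a hs ↦ ?_) hp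
  rw [scaleByDegree_monomial]
  exact (totalDegree_monomial_le _ _).trans hs

theorem pderiv_scaleByDegree (w : ℕ → ℝ) (i : σ) (p : MvPolynomial σ ℝ) :
    pderiv i (scaleByDegree w p) = scaleByDegree (fun d ↦ w (d + 1)) (pderiv i p) := by
  induction p using MvPolynomial.induction_on' with
  | monomial s a =>
    rw [scaleByDegree_monomial, pderiv_monomial, pderiv_monomial, scaleByDegree_monomial]
    by_cases hsi : s i = 0
    · simp [hsi]
    · have h1 : s - Finsupp.single i 1 + Finsupp.single i 1 = s :=
        tsub_add_cancel_of_le (Finsupp.single_le_iff.2 (Nat.one_le_iff_ne_zero.2 hsi))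
      have h2 := congrArg Finsupp.degree h1
      rw [map_add, Finsupp.degree_single] at h2
      rw [h2]
      congr 1
      ring
  | add p q hp hq => simp only [map_add, hp, hq]

variable [Fintype σ]

theorem scaleByDegree_euler (p : MvPolynomial σ ℝ) :
    scaleByDegree (fun d ↦ ((d : ℝ) + 1)⁻¹) (p + ∑ j, X j * pderiv j p) = p := by
  induction p using MvPolynomial.induction_on' with
  | monomial s a =>
    have h : ∑ j, X j * pderiv j (monomial s a) = monomial s (a * s.degree) := by
      simp_rw [X_mul_pderiv_monomial]
      rw [← Finset.sum_smul, ← Finsupp.degree_eq_sum, ← Nat.cast_smul_eq_nsmul ℝ, smul_monomial,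
        smul_eq_mul, mul_comm]
    have h0 : ((s.degree : ℝ) + 1) ≠ 0 := by positivity
    rw [h, ← map_add, scaleByDegree_monomial]
    congr 1
    field_simp
    ring
  | add p q hp hq =>
    rw [show p + q + ∑ j, X j * pderiv j (p + q) = (p + ∑ j, X j * pderiv j p) +
      (q + ∑ j, X j * pderiv j q) by simp only [map_add, mul_add, Finset.sum_add_distrib]; abel,
      map_add, hp, hq]

/-- The algebraic Poincaré lemma: a closed polynomial field of degree at most `k` is the gradient
of a polynomial of degree at most `k + 1`. Dividing the degree `d` part of `∑ j, X j * P j` by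
`d` gives the primitive, by Euler's identity. -/
theorem exists_forall_pderiv_eq {k : ℕ} (P : σ → MvPolynomial σ ℝ)
    (hP : ∀ i, (P i).totalDegree ≤ k) (h : ∀ i j, pderiv i (P j) = pderiv j (P i)) :
    ∃ p : MvPolynomial σ ℝ, p.totalDegree ≤ k + 1 ∧ ∀ i, pderiv i p = P i := by
  classical
  refine ⟨scaleByDegree (fun d ↦ (d : ℝ)⁻¹) (∑ j, X j * P j), ?_, fun i ↦ ?_⟩
  · refine totalDegree_scaleByDegree_le _ (totalDegree_finsetSum_le fun j _ ↦ ?_)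
    refine (totalDegree_mul _ _).trans ?_
    rw [totalDegree_X]
    have := hP j
    omega
  · have h1 : pderiv i (∑ j, X j * P j) = P i + ∑ j, X j * pderiv j (P i) := by
      simp_rw [map_sum, pderiv_mul, pderiv_X, Finset.sum_add_distrib, h i]
      congr 1
      rw [Finset.sum_eq_single i] <;> simp +contextual [eq_comm]
    rw [pderiv_scaleByDegree, h1]
    simpa using scaleByDegree_euler (P i)

end Polynomial

/-- The function on the plane given by a polynomial. -/
noncomputable def polyFun (p : MvPolynomial (Fin 2) ℝ) (x : Plane) : ℝ :=
  MvPolynomial.eval (fun i ↦ x i) p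

/-- The `1`-form with polynomial coefficients `P`. -/
noncomputable def polyForm (P : Fin 2 → MvPolynomial (Fin 2) ℝ) (x : Plane) : Plane →L[ℝ] ℝ :=
  ∑ i, polyFun (P i) x • EuclideanSpace.proj i

theorem polyForm_apply (P : Fin 2 → MvPolynomial (Fin 2) ℝ) (x v : Plane) :
    polyForm P x v = ∑ i, polyFun (P i) x * v i := by
  simp [polyForm]

theorem hasFDerivAt_polyFun (p : MvPolynomial (Fin 2) ℝ) (x : Plane) :
    HasFDerivAt (polyFun p) (polyForm (fun i ↦ MvPolynomial.pderiv i p) x) x := by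
  induction p using MvPolynomial.induction_on with
  | C a =>
    refine (hasFDerivAt_const a x).congr_fderiv ?_ |>.congr_of_eventuallyEq ?_
    · ext v
      simp [polyForm_apply, polyFun]
    · exact Filter.Eventually.of_forall fun y ↦ by simp [polyFun]
  | add p q hp hq =>
    refine (hp.add hq).congr_fderiv ?_ |>.congr_of_eventuallyEq ?_
    · ext v
      simp only [add_apply, polyForm_apply, polyFun, map_add]
      rw [← Finset.sum_add_distrib]
      simp_rw [add_mul]
    · exact Filter.Eventually.of_forall fun y ↦ by simp [polyFun]
  | mul_X p i hp =>
    have hX : HasFDerivAt (fun y : Plane ↦ y i) (EuclideanSpace.proj i : Plane →L[ℝ] ℝ) x :=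
      (EuclideanSpace.proj i : Plane →L[ℝ] ℝ).hasFDerivAt
    refine (hp.mul hX).congr_fderiv ?_ |>.congr_of_eventuallyEq ?_
    · ext v
      simp only [add_apply, smul_apply, polyForm_apply, polyFun, MvPolynomial.pderiv_mul,
        MvPolynomial.pderiv_X, map_add, map_mul, MvPolynomial.eval_X, Finset.mul_sum, add_mul,
        Finset.sum_add_distrib, smul_eq_mul, PiLp.proj_apply]
      rw [add_comm]
      congr 1
      · exact Finset.sum_congr rfl fun j _ ↦ by ring
      · rw [Finset.sum_eq_single i] <;> simp +contextual
    · exact Filter.Eventually.of_forall fun y ↦ by simp [polyFun]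

theorem continuous_polyFun (p : MvPolynomial (Fin 2) ℝ) : Continuous (polyFun p) :=
  continuous_iff_continuousAt.2 fun x ↦ (hasFDerivAt_polyFun p x).continuousAt

theorem continuous_polyForm (P : Fin 2 → MvPolynomial (Fin 2) ℝ) : Continuous (polyForm P) :=
  continuous_finsetSum _ fun i _ ↦ (continuous_polyFun (P i)).smul continuous_const

theorem isWeakPrimitive_polyFun (U : Set Plane) (p : MvPolynomial (Fin 2) ℝ) :
    IsWeakPrimitive U (polyFun p) (polyForm fun i ↦ MvPolynomial.pderiv i p) :=
  isWeakPrimitive_of_hasFDerivAt (fun x _ ↦ hasFDerivAt_polyFun p x)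
    (continuous_polyForm _).continuousOn

/-- A polynomial is determined by its values on a nonempty open set. -/
theorem polyFun_injOn_open {U : Set Plane} (hU : IsOpen U) (hne : U.Nonempty)
    {p q : MvPolynomial (Fin 2) ℝ} (h : ∀ x ∈ U, polyFun p x = polyFun q x) : p = q := by
  obtain ⟨x, hx⟩ := hne
  have hV : IsOpen {y : Fin 2 → ℝ | WithLp.toLp 2 y ∈ U} :=
    hU.preimage (PiLp.continuous_toLp 2 _)
  obtain ⟨ε, hε, hball⟩ := Metric.isOpen_iff.1 hV (fun i ↦ x i) hx
  refine MvPolynomial.funext_set (fun i ↦ Metric.ball (x i) ε) (fun i ↦ ?_) fun y hy ↦ ?_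
  · rw [Real.ball_eq_Ioo]
    exact Set.Ioo_infinite (by linarith)
  · rw [← ball_pi _ hε] at hy
    exact h (WithLp.toLp 2 y) (hball hy)

/-! ### Triangles of a triangulation -/

/-- A polygonal Lipschitz domain has no slits: below the graph that locally describes the boundary
there are points outside `closure Ω`. -/
theorem IsPolygonalDomain.interior_closure_subset {Ω : Set Plane} (hΩ : IsPolygonalDomain Ω) :
    interior (closure Ω) ⊆ Ω := by
  intro x hx
  by_contra hxΩ
  have hfr : x ∈ frontier Ω := by
    rw [hΩ.isOpen.frontier_eq]
    exact ⟨interior_subset hx, hxΩ⟩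
  obtain ⟨e, γ, L, hγ, hev⟩ := hΩ.lipschitz x hfr
  have hxle : e x 1 ≤ γ (e x 0) := by
    by_contra hlt
    exact hxΩ (hev.self_of_nhds.2 (not_le.1 hlt))
  -- Move down from `x` along the graph direction.
  let d : Plane := EuclideanSpace.single 1 1
  let z : ℝ → Plane := fun s ↦ x - s • e.symm d
  have hz : Continuous z := by fun_prop
  have hz0 : z 0 = x := by simp [z]
  have hez : ∀ s, e (z s) 0 = e x 0 ∧ e (z s) 1 = e x 1 - s := fun s ↦ by
    simp [z, d]
  have h1 : ∀ᶠ y in 𝓝 x, (∀ᶠ y' in 𝓝 y, (y' ∈ Ω ↔ γ (e y' 0) < e y' 1)) ∧ y ∈ closure Ω :=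
    hev.eventually_nhds.and (mem_interior_iff_mem_nhds.1 hx)
  have h2 : ∀ᶠ s in 𝓝 (0 : ℝ), (∀ᶠ y' in 𝓝 (z s), (y' ∈ Ω ↔ γ (e y' 0) < e y' 1)) ∧
      z s ∈ closure Ω := by
    have := hz.tendsto 0
    rw [hz0] at this
    exact this.eventually h1
  obtain ⟨s, ⟨hs1, hs2⟩, hs0⟩ :=
    ((h2.filter_mono nhdsWithin_le_nhds).and (self_mem_nhdsWithin (s := Set.Ioi (0 : ℝ)))).exists
  have hs0 : 0 < s := hs0
  have hlow : ∀ᶠ y' in 𝓝 (z s), e y' 1 < γ (e y' 0) := by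
    have hc0 : Continuous fun y' : Plane ↦ e y' 0 :=
      (EuclideanSpace.proj (𝕜 := ℝ) (0 : Fin 2)).continuous.comp e.continuous
    have hc1 : Continuous fun y' : Plane ↦ e y' 1 :=
      (EuclideanSpace.proj (𝕜 := ℝ) (1 : Fin 2)).continuous.comp e.continuous
    refine (isOpen_lt hc1 (hγ.continuous.comp hc0)).mem_nhds ?_
    change e (z s) 1 < γ (e (z s) 0)
    rw [(hez s).1, (hez s).2]
    linarith
  have hout : ∀ᶠ y' in 𝓝 (z s), y' ∉ Ω := by
    filter_upwards [hs1, hlow] with y' h3 h4 h5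
    exact lt_asymm h4 (h3.1 h5)
  exact (mem_closure_iff_frequently.1 hs2) hout

theorem ae_mem_interior_convexHull (Ω : Set Plane) (t : Finset Plane) :
    ∀ᵐ x ∂(volume.restrict Ω), x ∈ convexHull ℝ (t : Set Plane) →
      x ∈ interior (convexHull ℝ (t : Set Plane)) := by
  refine ae_restrict_of_ae ?_
  have h0 := (convex_convexHull ℝ (t : Set Plane)).addHaar_frontier volume
  filter_upwards [measure_eq_zero_iff_ae_notMem.1 h0] with x hx hxt
  by_contra hni
  exact hx ⟨subset_closure hxt, hni⟩

namespace Triangulation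

variable {Ω : Set Plane} (𝒯 : Triangulation Ω)

theorem interior_convexHull_subset (hΩ : IsPolygonalDomain Ω) {t : Finset Plane}
    (ht : t ∈ 𝒯.triangles) : interior (convexHull ℝ (t : Set Plane)) ⊆ Ω := by
  refine (interior_mono ?_).trans hΩ.interior_closure_subset
  rw [← 𝒯.cover]
  exact Set.subset_biUnion_of_mem (u := fun t : Finset Plane ↦ convexHull ℝ (t : Set Plane)) ht

theorem ae_exists_mem (hΩ : IsOpen Ω) : ∀ᵐ x ∂(volume.restrict Ω),
    ∃ t ∈ 𝒯.triangles, x ∈ convexHull ℝ (t : Set Plane) := by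
  filter_upwards [ae_restrict_mem hΩ.measurableSet] with x hx
  have : x ∈ ⋃ t ∈ 𝒯.triangles, convexHull ℝ (t : Set Plane) := 𝒯.cover ▸ subset_closure hx
  simpa using this

end Triangulation

theorem isCompact_convexHull_finset (t : Finset Plane) : IsCompact (convexHull ℝ (t : Set Plane)) :=
  t.finite_toSet.isCompact_convexHull ℝ

theorem IsPiecewisePoly.exists_ae_abs_le {Ω : Set Plane} (hΩ : IsOpen Ω) {𝒯 : Triangulation Ω}
    {k : ℕ} {f : Plane → ℝ} (hf : IsPiecewisePoly 𝒯 k f) :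
    ∃ M, ∀ᵐ x ∂(volume.restrict Ω), |f x| ≤ M := by
  have h : ∀ t ∈ 𝒯.triangles, ∃ M, ∀ᵐ x ∂(volume.restrict Ω),
      x ∈ convexHull ℝ (t : Set Plane) → |f x| ≤ M := by
    intro t ht
    obtain ⟨p, -, hp⟩ := hf t ht
    obtain ⟨M, hM⟩ := (isCompact_convexHull_finset t).exists_bound_of_continuousOn
      (continuous_polyFun p).continuousOn
    refine ⟨M, ?_⟩
    filter_upwards [hp] with x hx hxt
    rw [hx hxt]
    exact hM x hxt
  choose! M hM using h
  obtain ⟨B, hB⟩ := (𝒯.finite.image M).bddAbove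
  refine ⟨B, ?_⟩
  filter_upwards [(ae_ball_iff 𝒯.finite.countable).2 hM, 𝒯.ae_exists_mem hΩ] with x hx hxt
  obtain ⟨t, ht, hxt⟩ := hxt
  exact (hx t ht hxt).trans (hB ⟨t, ht, rfl⟩)

/-! ### Weak gradients as weak primitives -/

theorem inner_gradient_left (φ : Plane → ℝ) (x v : Plane) :
    inner ℝ (gradient φ x) v = fderiv ℝ φ x v := by
  rw [gradient, InnerProductSpace.toDual_symm_apply]

theorem IsTestFunction.continuous_gradient {Ω : Set Plane} {φ : Plane → ℝ}
    (hφ : IsTestFunction Ω φ) : Continuous (gradient φ) :=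
  (InnerProductSpace.toDual ℝ Plane).symm.continuous.comp hφ.continuous_fderiv

theorem IsTestFunction.hasCompactSupport_gradient {Ω : Set Plane} {φ : Plane → ℝ}
    (hφ : IsTestFunction Ω φ) : HasCompactSupport (gradient φ) :=
  (hφ.compact.fderiv ℝ).comp_left (g := (InnerProductSpace.toDual ℝ Plane).symm) (map_zero _)

theorem L2.locallyIntegrable {E : Type*} [NormedAddCommGroup E] {μ : Measure Plane}
    (u : Lp E 2 μ) [IsLocallyFiniteMeasure μ] : LocallyIntegrable u μ :=
  (Lp.memLp u).locallyIntegrable one_le_two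

theorem locallyIntegrableOn_L2 {E : Type*} [NormedAddCommGroup E] {Ω : Set Plane}
    (u : Lp E 2 (volume.restrict Ω)) : LocallyIntegrableOn u Ω :=
  locallyIntegrableOn_of_locallyIntegrable_restrict (L2.locallyIntegrable u)

/-- A weak gradient in the sense of `HasWeakGradient` is a weak derivative given by the dual
`1`-form. The values outside `Ω` of the chosen representatives are arbitrary, but do not matter, as
test functions vanish there. -/
theorem hasWeakGradient_iff {Ω : Set Plane} {u : L2 Ω} {g : L2Vec Ω} :
    HasWeakGradient u g ↔ IsWeakPrimitive Ω u (fun x ↦ innerSL ℝ (g x)) := by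
  refine forall_congr' fun φ ↦ forall_congr' fun hφ ↦ ?_
  have hi1 : Integrable (fun x ↦ u x • gradient φ x) (volume.restrict Ω) :=
    (L2.locallyIntegrable u).integrable_smul_right_of_hasCompactSupport hφ.continuous_gradient
      hφ.hasCompactSupport_gradient
  have hi2 : Integrable (fun x ↦ φ x • g x) (volume.restrict Ω) :=
    (L2.locallyIntegrable g).integrable_smul_left_of_hasCompactSupport hφ.continuous hφ.compact
  have h1 : ∀ v, inner ℝ (∫ x in Ω, u x • gradient φ x) v = ∫ x, u x * fderiv ℝ φ x v := fun v ↦ by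
    rw [real_inner_comm, ← integral_inner hi1, setIntegral_eq_integral_of_forall_compl_eq_zero]
    · simp_rw [inner_smul_right, real_inner_comm _ v, inner_gradient_left]
    · intro x hx
      rw [inner_smul_right, real_inner_comm, inner_gradient_left, hφ.fderiv_apply_eq_zero hx,
        mul_zero]
  have h2 : ∀ v, inner ℝ (∫ x in Ω, φ x • g x) v = ∫ x, φ x * innerSL ℝ (g x) v := fun v ↦ by
    rw [real_inner_comm, ← integral_inner hi2, setIntegral_eq_integral_of_forall_compl_eq_zero]
    · simp_rw [inner_smul_right, real_inner_comm _ v]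
      rfl
    · intro x hx
      rw [hφ.eq_zero hx, zero_smul, inner_zero_right]
  constructor
  · intro h v
    rw [← h1, ← h2, h, inner_neg_left]
  · intro h
    refine ext_inner_right ℝ fun v ↦ ?_
    rw [inner_neg_left, h1, h2, h v]

theorem IsWeakPrimitive.congr_ae {U : Set Plane} (hU : MeasurableSet U) {f f' : Plane → ℝ}
    {η η' : Plane → Plane →L[ℝ] ℝ}
    (h : IsWeakPrimitive U f η) (hf : ∀ᵐ x ∂(volume.restrict U), f x = f' x)
    (hη : ∀ᵐ x ∂(volume.restrict U), η x = η' x) : IsWeakPrimitive U f' η' := by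
  intro φ hφ v
  rw [ae_restrict_iff' hU] at hf hη
  have h1 : ∫ x, f x * fderiv ℝ φ x v = ∫ x, f' x * fderiv ℝ φ x v := by
    refine integral_congr_ae ?_
    filter_upwards [hf] with x hx
    by_cases hxU : x ∈ U
    · rw [hx hxU]
    · rw [hφ.fderiv_apply_eq_zero hxU, mul_zero, mul_zero]
  have h2 : ∫ x, φ x * η x v = ∫ x, φ x * η' x v := by
    refine integral_congr_ae ?_
    filter_upwards [hη] with x hx
    by_cases hxU : x ∈ U
    · rw [hx hxU]
    · rw [hφ.eq_zero hxU, zero_mul, zero_mul]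
  rw [← h1, ← h2, h φ hφ v]

/-- A function is a weak primitive of at most one form, up to null sets. -/
theorem IsWeakPrimitive.ae_eq {U : Set Plane} (hU : IsOpen U) {f : Plane → ℝ}
    {η η' : Plane → Plane →L[ℝ] ℝ} (h : IsWeakPrimitive U f η) (h' : IsWeakPrimitive U f η')
    (hη : LocallyIntegrableOn η U) (hη' : LocallyIntegrableOn η' U) :
    ∀ᵐ x, x ∈ U → η x = η' x := by
  have h0 : ∀ᵐ x, x ∈ U → (η - η') x = 0 := by
    refine hU.ae_eq_zero_of_integral_contDiff_smul_eq_zero (hη.sub hη') fun φ h1 h2 h3 ↦ ?_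
    have hφ : IsTestFunction U φ := ⟨h1, h2, h3⟩
    have hi : ∀ ζ : Plane → Plane →L[ℝ] ℝ, LocallyIntegrableOn ζ U →
        Integrable (fun x ↦ φ x • ζ x) := fun ζ hζ ↦ by
      have h4 : IntegrableOn (fun x ↦ φ x • ζ x) (tsupport φ) :=
        (hζ.integrableOn_compact_subset h3 h2).continuousOn_smul hφ.continuous.continuousOn h2
      refine IntegrableOn.integrable_of_forall_notMem_eq_zero (ε' := Plane →L[ℝ] ℝ) h4 fun x hx ↦ ?_
      rw [image_eq_zero_of_notMem_tsupport hx, zero_smul]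
    ext v
    have hi' := (hi η hη).sub (hi η' hη')
    have he : (fun x ↦ φ x • (η - η') x) = fun x ↦ φ x • η x - φ x • η' x := by
      ext1 x
      simp [smul_sub]
    rw [he, integral_sub (hi η hη) (hi η' hη'), sub_apply,
      ContinuousLinearMap.integral_apply (hi η hη), ContinuousLinearMap.integral_apply (hi η' hη')]
    have e1 := h φ hφ v
    have e2 := h' φ hφ v
    simp only [smul_apply, smul_eq_mul, zero_apply]
    linarith
  filter_upwards [h0] with x hx hxU
  exact sub_eq_zero.1 (hx hxU)

theorem locallyIntegrableOn_innerSL {Ω : Set Plane} (g : L2Vec Ω) :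
    LocallyIntegrableOn (fun x ↦ innerSL ℝ (g x)) Ω := fun x hx ↦
  (locallyIntegrableOn_L2 g x hx).imp fun _ hs ↦
    ⟨hs.1, (innerSL ℝ (E := Plane)).integrable_comp hs.2⟩

theorem HasWeakGradient.unique {Ω : Set Plane} (hΩ : IsOpen Ω) {u : L2 Ω} {g g' : L2Vec Ω}
    (h : HasWeakGradient u g) (h' : HasWeakGradient u g') : g = g' := by
  have := (hasWeakGradient_iff.1 h).ae_eq hΩ (hasWeakGradient_iff.1 h') 
    (locallyIntegrableOn_innerSL g) (locallyIntegrableOn_innerSL g')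
  refine Lp.ext ?_
  rw [← ae_restrict_iff' hΩ.measurableSet] at this
  filter_upwards [this] with x hx
  refine ext_inner_right ℝ fun v ↦ ?_
  exact congrArg (fun L : Plane →L[ℝ] ℝ ↦ L v) hx

/-! ### Gradients of test functions and weak Curls -/

theorem gradient_apply (φ : Plane → ℝ) (x : Plane) (i : Fin 2) :
    gradient φ x i = fderiv ℝ φ x (EuclideanSpace.single i 1) := by
  rw [← inner_gradient_left, EuclideanSpace.inner_single_right]
  simp

theorem IsTestFunction.fderiv_apply {U : Set Plane} {φ : Plane → ℝ} (hφ : IsTestFunction U φ)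
    (v : Plane) : IsTestFunction U (fun x ↦ fderiv ℝ φ x v) where
  smooth := (hφ.smooth.fderiv_right (m := ∞) (by simp)).clm_apply contDiff_const
  compact := hφ.hasCompactSupport_fderiv_apply v
  support := (tsupport_fderiv_apply_subset ℝ v).trans hφ.support

theorem IsTestFunction.fderiv_fderiv_apply_comm {U : Set Plane} {φ : Plane → ℝ}
    (hφ : IsTestFunction U φ) (x v w : Plane) :
    fderiv ℝ (fun y ↦ fderiv ℝ φ y v) x w = fderiv ℝ (fun y ↦ fderiv ℝ φ y w) x v := by
  have hd : DifferentiableAt ℝ (fderiv ℝ φ) x :=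
    (hφ.smooth.fderiv_right (m := 1) (by norm_cast)).differentiable (by simp) x
  have hs : IsSymmSndFDerivAt ℝ φ x :=
    (hφ.smooth.of_le (m := 2) (WithTop.coe_le_coe.2 le_top)).contDiffAt.isSymmSndFDerivAt (by simp)
  have hf : ∀ v, fderiv ℝ (fun y ↦ fderiv ℝ φ y v) x = (fderiv ℝ (fderiv ℝ φ) x).flip v :=
    fun v ↦ by
      ext u
      rw [fderiv_clm_apply hd (differentiableAt_const v)]
      simp
  rw [hf, hf]
  exact hs w v

theorem IsWeakPrimitive.isWeaklyClosed {U : Set Plane} {f : Plane → ℝ}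
    {η : Plane → Plane →L[ℝ] ℝ} (h : IsWeakPrimitive U f η) : IsWeaklyClosed U η := by
  intro φ hφ v w
  have h1 := h _ (hφ.fderiv_apply v) w
  have h2 := h _ (hφ.fderiv_apply w) v
  simp_rw [hφ.fderiv_fderiv_apply_comm _ v w] at h1
  linarith

/-- The gradients of test functions, as a subspace of `L²(Ω; ℝ²)`. -/
noncomputable def testGradients (Ω : Set Plane) : Submodule ℝ (L2Vec Ω) where
  carrier := {g | ∃ φ, IsTestFunction Ω φ ∧ ∀ᵐ x ∂(volume.restrict Ω), g x = gradient φ x}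
  zero_mem' := by
    refine ⟨0, ⟨contDiff_const, HasCompactSupport.zero, by simp [tsupport]⟩, ?_⟩
    filter_upwards [Lp.coeFn_zero Plane 2 (volume.restrict Ω)] with x hx
    rw [hx]
    ext i
    simp [gradient_apply]
  add_mem' := by
    rintro g h ⟨φ, hφ, hg⟩ ⟨ψ, hψ, hh⟩
    refine ⟨φ + ψ, ⟨hφ.smooth.add hψ.smooth, hφ.compact.add hψ.compact,
      (tsupport_add φ ψ).trans (Set.union_subset hφ.support hψ.support)⟩, ?_⟩
    filter_upwards [Lp.coeFn_add g h, hg, hh] with x hx h1 h2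
    rw [hx, Pi.add_apply, h1, h2]
    ext i
    rw [PiLp.add_apply, gradient_apply, gradient_apply, gradient_apply, fderiv_add
      (hφ.smooth.differentiable (by simp) x) (hψ.smooth.differentiable (by simp) x)]
    rfl
  smul_mem' := by
    rintro c g ⟨φ, hφ, hg⟩
    refine ⟨c • φ, ⟨hφ.smooth.const_smul c, hφ.compact.smul_left (f := fun _ ↦ c),
      (tsupport_smul_subset_right (fun _ ↦ c) φ).trans hφ.support⟩, ?_⟩
    filter_upwards [Lp.coeFn_smul c g, hg] with x hx h1
    rw [hx, Pi.smul_apply, h1]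
    ext i
    rw [PiLp.smul_apply, gradient_apply, gradient_apply, fderiv_const_smul
      (hφ.smooth.differentiable (by simp) x)]
    rfl

theorem IsTestFunction.memLp_gradient {Ω : Set Plane} {φ : Plane → ℝ} (hφ : IsTestFunction Ω φ) :
    MemLp (gradient φ) 2 (volume.restrict Ω) :=
  hφ.continuous_gradient.memLp_of_hasCompactSupport hφ.hasCompactSupport_gradient

theorem IsTestFunction.toLp_gradient_mem {Ω : Set Plane} {φ : Plane → ℝ}
    (hφ : IsTestFunction Ω φ) : hφ.memLp_gradient.toLp ∈ testGradients Ω :=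
  ⟨φ, hφ, hφ.memLp_gradient.coeFn_toLp⟩

theorem testGradients_subset_gradH1Zero {Ω : Set Plane} (hΩ : IsOpen Ω) :
    (testGradients Ω : Set (L2Vec Ω)) ⊆ gradH1Zero Ω := by
  rintro g ⟨φ, hφ, hg⟩
  have hm : MemLp φ 2 (volume.restrict Ω) :=
    hφ.continuous.memLp_of_hasCompactSupport hφ.compact
  have hu := hm.coeFn_toLp
  have hw : HasWeakGradient (hm.toLp φ) g := by
    rw [hasWeakGradient_iff]
    refine (isWeakPrimitive_of_hasFDerivAt (η := fderiv ℝ φ)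
      (fun x _ ↦ (hφ.smooth.differentiable (by simp) x).hasFDerivAt)
      hφ.continuous_fderiv.continuousOn).congr_ae hΩ.measurableSet ?_ ?_
    · filter_upwards [hu] with x hx using hx.symm
    · filter_upwards [hg] with x hx
      ext v
      rw [hx, innerSL_apply_apply, inner_gradient_left]
  refine ⟨hm.toLp φ, ⟨g, hw, fun _ ↦ φ, fun _ ↦ hφ, ?_, ?_⟩, hw⟩
  · refine tendsto_const_nhds.congr fun _ ↦ ?_
    rw [eq_comm, ← eLpNorm_zero (ε := ℝ) (p := 2) (μ := volume.restrict Ω)]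
    refine eLpNorm_congr_ae ?_
    filter_upwards [hu] with x hx
    simp [hx]
  · refine tendsto_const_nhds.congr fun _ ↦ ?_
    rw [eq_comm, ← eLpNorm_zero (ε := Plane) (p := 2) (μ := volume.restrict Ω)]
    refine eLpNorm_congr_ae ?_
    filter_upwards [hg] with x hx
    simp [hx]

/-- `∇H¹₀(Ω)` lies in the closure of the gradients of test functions. -/
theorem gradH1Zero_subset_closure {Ω : Set Plane} (hΩ : IsOpen Ω) :
    gradH1Zero Ω ⊆ closure (testGradients Ω : Set (L2Vec Ω)) := by
  rintro g ⟨u, ⟨g', hg', φ, hφ, -, hlim⟩, hg⟩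
  obtain rfl := hg.unique hΩ hg'
  refine mem_closure_of_tendsto (f := fun n ↦ (hφ n).memLp_gradient.toLp) (b := atTop) ?_
    (Eventually.of_forall fun n ↦ (hφ n).toLp_gradient_mem)
  rw [Lp.tendsto_Lp_iff_tendsto_eLpNorm']
  refine hlim.congr fun n ↦ eLpNorm_congr_ae ?_
  filter_upwards [(hφ n).memLp_gradient.coeFn_toLp] with x hx
  simp [hx]

theorem inner_eq_setIntegral_of_ae_eq_gradient {Ω : Set Plane} {φ : Plane → ℝ} {q g : L2Vec Ω}
    (hg : ∀ᵐ x ∂(volume.restrict Ω), g x = gradient φ x) :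
    inner ℝ q g = ∫ x in Ω, (fderiv ℝ φ x (EuclideanSpace.single 0 1) * q x 0 +
      fderiv ℝ φ x (EuclideanSpace.single 1 1) * q x 1) := by
  rw [L2.inner_def]
  refine integral_congr_ae ?_
  filter_upwards [hg] with x hx
  rw [hx, PiLp.inner_apply, Fin.sum_univ_two, ← gradient_apply, ← gradient_apply]
  simp

theorem integrable_fderiv_mul {Ω : Set Plane} {φ : Plane → ℝ} (hφ : IsTestFunction Ω φ)
    (g : L2Vec Ω) (v : Plane) (i : Fin 2) :
    Integrable (fun x ↦ fderiv ℝ φ x v * g x i) (volume.restrict Ω) := by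
  have h1 : Integrable (fun x ↦ fderiv ℝ φ x v • g x) (volume.restrict Ω) :=
    (L2.locallyIntegrable g).integrable_smul_left_of_hasCompactSupport
      (hφ.continuous_fderiv_apply v) (hφ.hasCompactSupport_fderiv_apply v)
  simpa using (EuclideanSpace.proj (𝕜 := ℝ) i).integrable_comp h1

/-- Weak Curls are orthogonal to the gradients of test functions. -/
theorem HasWeakCurl.inner_testGradient_eq_zero {Ω : Set Plane} {β : L2 Ω} {c g : L2Vec Ω}
    (hc : HasWeakCurl β c) (hg : g ∈ testGradients Ω) : inner ℝ c g = 0 := by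
  obtain ⟨φ, hφ, hg⟩ := hg
  obtain ⟨G, hG, hcG⟩ := hc
  have h := (hasWeakGradient_iff.1 hG).isWeaklyClosed φ hφ (EuclideanSpace.single 0 1)
    (EuclideanSpace.single 1 1)
  rw [← setIntegral_eq_integral_of_forall_compl_eq_zero (s := Ω),
    ← setIntegral_eq_integral_of_forall_compl_eq_zero (s := Ω)
      (f := fun x ↦ fderiv ℝ φ x (EuclideanSpace.single 1 1) * _)] at h
  · rw [inner_eq_setIntegral_of_ae_eq_gradient hg,
      integral_add (integrable_fderiv_mul hφ c _ 0) (integrable_fderiv_mul hφ c _ 1)]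
    have h1 : ∫ x in Ω, fderiv ℝ φ x (EuclideanSpace.single 0 1) * c x 0 =
        ∫ x in Ω, fderiv ℝ φ x (EuclideanSpace.single 0 1) *
          innerSL ℝ (G x) (EuclideanSpace.single 1 1) := by
      refine integral_congr_ae ?_
      filter_upwards [hcG] with x hx
      rw [hx.1, innerSL_apply_apply, EuclideanSpace.inner_single_right]
      simp
    have h2 : ∫ x in Ω, fderiv ℝ φ x (EuclideanSpace.single 1 1) * c x 1 =
        -∫ x in Ω, fderiv ℝ φ x (EuclideanSpace.single 1 1) *
          innerSL ℝ (G x) (EuclideanSpace.single 0 1) := by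
      rw [← integral_neg]
      refine integral_congr_ae ?_
      filter_upwards [hcG] with x hx
      rw [hx.2, innerSL_apply_apply, EuclideanSpace.inner_single_right]
      simp
    rw [h1, h2, h, add_neg_cancel]
  · intro x hx
    rw [hφ.fderiv_apply_eq_zero hx, zero_mul]
  · intro x hx
    rw [hφ.fderiv_apply_eq_zero hx, zero_mul]

theorem HasWeakCurl.inner_gradH1Zero_eq_zero {Ω : Set Plane} (hΩ : IsOpen Ω) {β : L2 Ω}
    {c g : L2Vec Ω} (hc : HasWeakCurl β c) (hg : g ∈ gradH1Zero Ω) : inner ℝ c g = 0 := by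
  have hcl : IsClosed {g : L2Vec Ω | inner ℝ c g = 0} :=
    isClosed_eq (continuous_const.inner continuous_id) continuous_const
  exact closure_minimal (fun g hg ↦ hc.inner_testGradient_eq_zero hg) hcl
    (gradH1Zero_subset_closure hΩ hg)

/-! ### Curls of piecewise polynomials -/

/-- The Curl of a piecewise polynomial function of degree `k + 1` in `H¹(Ω)` is a piecewise
polynomial field of degree `k`. -/
theorem HasWeakCurl.mem_Xh {Ω : Set Plane} (hΩ : IsOpen Ω) {𝒯 : Triangulation Ω} {k : ℕ}
    {β : L2 Ω} {c : L2Vec Ω} (hβ : IsPiecewisePoly 𝒯 (k + 1) β) (hc : HasWeakCurl β c) :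
    c ∈ Xh 𝒯 k := by
  obtain ⟨g, hg, hcg⟩ := hc
  have key : ∀ t ∈ 𝒯.triangles, ∃ p : MvPolynomial (Fin 2) ℝ, p.totalDegree ≤ k + 1 ∧
      ∀ᵐ x ∂(volume.restrict Ω), x ∈ convexHull ℝ (t : Set Plane) →
        ∀ i, g x i = polyFun (MvPolynomial.pderiv i p) x := by
    intro t ht
    obtain ⟨p, hp, hpβ⟩ := hβ t ht
    refine ⟨p, hp, ?_⟩
    have hUo : IsOpen (Ω ∩ interior (convexHull ℝ (t : Set Plane))) := hΩ.inter isOpen_interior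
    have h1 : IsWeakPrimitive (Ω ∩ interior (convexHull ℝ (t : Set Plane))) (polyFun p)
        (fun x ↦ innerSL ℝ (g x)) := by
      refine ((hasWeakGradient_iff.1 hg).mono Set.inter_subset_left).congr_ae hUo.measurableSet
        ?_ (Eventually.of_forall fun _ ↦ rfl)
      filter_upwards [ae_restrict_of_ae_restrict_of_subset Set.inter_subset_left hpβ,
        ae_restrict_mem hUo.measurableSet] with x hx hxU
      exact hx (interior_subset hxU.2)
    have h2 := h1.ae_eq hUo (isWeakPrimitive_polyFun _ p)
      ((locallyIntegrableOn_innerSL g).mono_set Set.inter_subset_left)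
      ((continuous_polyForm _).locallyIntegrable.locallyIntegrableOn _)
    filter_upwards [ae_restrict_of_ae h2, ae_mem_interior_convexHull Ω t,
      ae_restrict_mem hΩ.measurableSet] with x hx hxi hxΩ hxt i
    have h3 := congrArg (fun L : Plane →L[ℝ] ℝ ↦ L (EuclideanSpace.single i 1))
      (hx ⟨hxΩ, hxi hxt⟩)
    simpa [polyForm_apply, EuclideanSpace.inner_single_right, Pi.single_apply] using h3
  intro i t ht
  obtain ⟨p, hp, hpg⟩ := key t ht
  fin_cases i
  · refine ⟨MvPolynomial.pderiv 1 p, totalDegree_pderiv_le 1 hp, ?_⟩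
    filter_upwards [hcg, hpg] with x h1 h2 hxt
    exact h1.1.trans (h2 hxt 1)
  · refine ⟨-MvPolynomial.pderiv 0 p, ?_, ?_⟩
    · rw [MvPolynomial.totalDegree_neg]
      exact totalDegree_pderiv_le 0 hp
    · filter_upwards [hcg, hpg] with x h1 h2 hxt
      rw [map_neg]
      exact h1.2.trans (congrArg Neg.neg (h2 hxt 0))

/-! ### Divergence-free piecewise polynomials are Curls -/

/-- The rotation `(v₀, v₁) ↦ (-v₁, v₀)`, which turns `Curl β` into `∇β`. -/
noncomputable def quarterTurn : Plane →L[ℝ] Plane :=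
  (-EuclideanSpace.proj (𝕜 := ℝ) (1 : Fin 2)).smulRight (EuclideanSpace.single 0 1) +
    (EuclideanSpace.proj (𝕜 := ℝ) (0 : Fin 2)).smulRight (EuclideanSpace.single 1 1)

theorem quarterTurn_apply_zero (v : Plane) : quarterTurn v 0 = -v 1 := by
  simp [quarterTurn]

theorem quarterTurn_apply_one (v : Plane) : quarterTurn v 1 = v 0 := by
  simp [quarterTurn]

/-- A field orthogonal to the gradients of all test functions is divergence-free, i.e. its quarter
turn is curl-free. -/
theorem isWeaklyClosed_quarterTurn {Ω : Set Plane} (hΩ : IsOpen Ω) {q : L2Vec Ω}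
    (h : ∀ g ∈ testGradients Ω, inner ℝ q g = 0) :
    IsWeaklyClosed Ω (Ω.indicator fun x ↦ innerSL ℝ (quarterTurn (q x))) := by
  intro φ hφ v w
  have h0 := h _ hφ.toLp_gradient_mem
  rw [inner_eq_setIntegral_of_ae_eq_gradient hφ.memLp_gradient.coeFn_toLp] at h0
  have hval : ∀ v w, ∫ x, fderiv ℝ φ x v * Ω.indicator (fun x ↦ innerSL ℝ (quarterTurn (q x))) x w =
      ∫ x in Ω, (fderiv ℝ φ x v * q x 0 * w 1 - fderiv ℝ φ x v * q x 1 * w 0) := by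
    intro v w
    rw [← setIntegral_eq_integral_of_forall_compl_eq_zero (s := Ω) fun x hx ↦ by
      rw [hφ.fderiv_apply_eq_zero hx, zero_mul]]
    refine integral_congr_ae ?_
    have hq : ∀ x, innerSL ℝ (quarterTurn (q x)) w = q x 0 * w 1 - q x 1 * w 0 := fun x ↦ by
      rw [innerSL_apply_apply, PiLp.inner_apply, Fin.sum_univ_two, quarterTurn_apply_zero,
        quarterTurn_apply_one]
      simp
      ring
    filter_upwards [ae_restrict_mem hΩ.measurableSet] with x hx
    rw [Set.indicator_of_mem hx, hq]
    ring
  have hint : ∀ v w : Plane, Integrable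
      (fun x ↦ fderiv ℝ φ x v * q x 0 * w 1 - fderiv ℝ φ x v * q x 1 * w 0)
      (volume.restrict Ω) := fun v w ↦
    ((integrable_fderiv_mul hφ q v 0).mul_const _).sub
      ((integrable_fderiv_mul hφ q v 1).mul_const _)
  have hfd : ∀ x v, fderiv ℝ φ x v = v 0 * fderiv ℝ φ x (EuclideanSpace.single 0 1) +
      v 1 * fderiv ℝ φ x (EuclideanSpace.single 1 1) := fun x v ↦ by
    rw [← gradient_apply, ← gradient_apply, ← inner_gradient_left, PiLp.inner_apply,
      Fin.sum_univ_two]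
    simp
  rw [hval, hval, ← sub_eq_zero, ← integral_sub (hint v w) (hint w v),
    ← mul_zero (v 0 * w 1 - v 1 * w 0), ← h0, ← integral_const_mul]
  refine integral_congr_ae (Eventually.of_forall fun x ↦ ?_)
  simp only [hfd x v, hfd x w]
  ring

/-- A continuous weak primitive of a polynomial field on a connected open set is a polynomial. -/
theorem exists_polyFun_of_isWeakPrimitive {U : Set Plane} (hU : IsOpen U) (hUc : IsPreconnected U)
    (hne : U.Nonempty) {F : Plane → ℝ} (hF : ContinuousOn F U) {k : ℕ}
    {P : Fin 2 → MvPolynomial (Fin 2) ℝ} (hP : ∀ i, (P i).totalDegree ≤ k)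
    (h : IsWeakPrimitive U F (polyForm P)) :
    ∃ p : MvPolynomial (Fin 2) ℝ, p.totalDegree ≤ k + 1 ∧ ∀ x ∈ U, F x = polyFun p x := by
  have hform : ∀ (P : Fin 2 → MvPolynomial (Fin 2) ℝ) (x : Plane) (i : Fin 2),
      polyForm P x (EuclideanSpace.single i 1) = polyFun (P i) x := fun P x i ↦ by
    simp [polyForm_apply]
  have hclosed : ∀ i j, MvPolynomial.pderiv i (P j) = MvPolynomial.pderiv j (P i) := by
    intro i j
    let D : Plane → ℝ := fun x ↦ polyFun (MvPolynomial.pderiv i (P j)) x -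
      polyFun (MvPolynomial.pderiv j (P i)) x
    have hD : Continuous D := (continuous_polyFun _).sub (continuous_polyFun _)
    have hae : ∀ᵐ x, x ∈ U → D x = 0 := by
      refine hU.ae_eq_zero_of_integral_contDiff_smul_eq_zero
        (hD.locallyIntegrable.locallyIntegrableOn U) fun φ h1 h2 h3 ↦ ?_
      have hφ : IsTestFunction U φ := ⟨h1, h2, h3⟩
      have e := h.isWeaklyClosed φ hφ (EuclideanSpace.single i 1) (EuclideanSpace.single j 1)
      have e1 := isWeakPrimitive_polyFun U (P j) φ hφ (EuclideanSpace.single i 1)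
      have e2 := isWeakPrimitive_polyFun U (P i) φ hφ (EuclideanSpace.single j 1)
      simp_rw [hform] at e e1 e2
      simp_rw [mul_comm (polyFun _ _)] at e1 e2
      have hint : ∀ p, Integrable (fun x ↦ φ x * polyFun p x) := fun p ↦
        (hφ.continuous.mul (continuous_polyFun p)).integrable_of_hasCompactSupport
          hφ.compact.mul_right
      simp only [D, smul_eq_mul, mul_sub]
      rw [integral_sub (hint _) (hint _)]
      linarith
    have hEq : Set.EqOn D 0 U := by
      refine Measure.eqOn_open_of_ae_eq (μ := volume) ?_ hU hD.continuousOn continuousOn_const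
      exact (ae_restrict_iff' hU.measurableSet).2 hae
    exact polyFun_injOn_open hU hne fun x hx ↦ sub_eq_zero.1 (hEq hx)
  obtain ⟨p, hp, hpP⟩ := exists_forall_pderiv_eq P hP hclosed
  have hp' : IsWeakPrimitive U (polyFun p) (polyForm P) := by
    have := isWeakPrimitive_polyFun U p
    simp_rw [hpP] at this
    exact this
  obtain ⟨c, hc⟩ := exists_eq_add_of_isWeakPrimitive hU hUc hF (continuous_polyFun p).continuousOn
    h hp'
  refine ⟨p + MvPolynomial.C c, (MvPolynomial.totalDegree_add _ _).trans ?_, fun x hx ↦ ?_⟩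
  · simp [hp]
  · rw [hc x hx]
    simp [polyFun]

theorem exists_ae_norm_le_of_mem_Xh {Ω : Set Plane} (hΩ : IsOpen Ω) {𝒯 : Triangulation Ω} {k : ℕ}
    {q : L2Vec Ω} (hq : q ∈ Xh 𝒯 k) : ∃ M, ∀ᵐ x ∂(volume.restrict Ω), ‖q x‖ ≤ M := by
  obtain ⟨M, hM⟩ := IsPiecewisePoly.exists_ae_abs_le hΩ (hq 0)
  obtain ⟨N, hN⟩ := IsPiecewisePoly.exists_ae_abs_le hΩ (hq 1)
  refine ⟨√(M ^ 2 + N ^ 2), ?_⟩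
  filter_upwards [hM, hN] with x h1 h2
  rw [EuclideanSpace.norm_eq, Fin.sum_univ_two]
  refine Real.sqrt_le_sqrt (add_le_add ?_ ?_) <;>
  · rw [Real.norm_eq_abs]
    gcongr

/-- A divergence-free piecewise polynomial field is, on a polygonal domain, the `Curl` of a function
that is continuous on the domain and piecewise polynomial. -/
theorem exists_isWeakPrimitive_of_mem_Xh {Ω : Set Plane} (hΩ : IsPolygonalDomain Ω)
    {𝒯 : Triangulation Ω} {k : ℕ} {q : L2Vec Ω} (hq : q ∈ Xh 𝒯 k)
    (h : ∀ g ∈ testGradients Ω, inner ℝ q g = 0) :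
    ∃ F : Plane → ℝ, ContinuousOn F Ω ∧
      IsWeakPrimitive Ω F (fun x ↦ innerSL ℝ (quarterTurn (q x))) ∧
      IsPiecewisePoly 𝒯 (k + 1) F := by
  have hmeas := hΩ.isOpen.measurableSet
  obtain ⟨M, hM⟩ := exists_ae_norm_le_of_mem_Xh hΩ.isOpen hq
  have hm : AEStronglyMeasurable (Ω.indicator fun x ↦ innerSL ℝ (quarterTurn (q x))) := by
    rw [aestronglyMeasurable_indicator_iff hmeas]
    exact ((innerSL ℝ).continuous.comp quarterTurn.continuous).comp_aestronglyMeasurable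
      (Lp.aestronglyMeasurable q)
  have hb : ∀ᵐ x, ‖Ω.indicator (fun x ↦ innerSL ℝ (quarterTurn (q x))) x‖ ≤
      max (‖quarterTurn‖ * M) 0 := by
    filter_upwards [(ae_restrict_iff' hmeas).1 hM] with x hx
    by_cases hxΩ : x ∈ Ω
    · rw [Set.indicator_of_mem hxΩ, innerSL_apply_norm]
      exact (quarterTurn.le_opNorm_of_le (hx hxΩ)).trans (le_max_left _ _)
    · rw [Set.indicator_of_notMem hxΩ, norm_zero]
      exact le_max_right _ _
  obtain ⟨F, hFc, hF⟩ := (isWeaklyClosed_quarterTurn hΩ.isOpen h).exists_isWeakPrimitive hΩ.isOpen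
    hΩ.isSimplyConnected hm hb
  have hF' : IsWeakPrimitive Ω F (fun x ↦ innerSL ℝ (quarterTurn (q x))) := by
    refine hF.congr_ae hmeas (Eventually.of_forall fun _ ↦ rfl) ?_
    filter_upwards [ae_restrict_mem hmeas] with x hx using Set.indicator_of_mem hx _
  refine ⟨F, hFc, hF', fun t ht ↦ ?_⟩
  have hUΩ := 𝒯.interior_convexHull_subset hΩ ht
  set U := interior (convexHull ℝ (t : Set Plane)) with hU
  -- If the interior is empty, the convex set is null and any polynomial will do.
  rcases U.eq_empty_or_nonempty with hUe | hUne
  · refine ⟨0, by simp, ?_⟩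
    filter_upwards [ae_mem_interior_convexHull Ω t] with x hx hxt
    have := hx hxt
    rw [← hU, hUe] at this
    exact this.elim
  obtain ⟨p₀, hp₀, hq₀⟩ := hq 0 t ht
  obtain ⟨p₁, hp₁, hq₁⟩ := hq 1 t ht
  have hW : IsWeakPrimitive U F (polyForm ![-p₁, p₀]) := by
    refine (hF'.mono hUΩ).congr_ae isOpen_interior.measurableSet
      (Eventually.of_forall fun _ ↦ rfl) ?_
    filter_upwards [ae_restrict_of_ae_restrict_of_subset hUΩ hq₀,
      ae_restrict_of_ae_restrict_of_subset hUΩ hq₁,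
      ae_restrict_mem (μ := volume) (s := U) isOpen_interior.measurableSet] with x h0 h1 hxU
    have hxt := interior_subset hxU
    ext v
    rw [innerSL_apply_apply, polyForm_apply, PiLp.inner_apply, Fin.sum_univ_two, Fin.sum_univ_two,
      quarterTurn_apply_zero, quarterTurn_apply_one, h0 hxt, h1 hxt]
    simp [polyFun, mul_comm]
  obtain ⟨p, hp, hFp⟩ := exists_polyFun_of_isWeakPrimitive (k := k) isOpen_interior
    (convex_convexHull ℝ (t : Set Plane)).interior.isPreconnected hUne (hFc.mono hUΩ)
    (fun i ↦ by fin_cases i <;> simp [hp₀, hp₁, MvPolynomial.totalDegree_neg]) hW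
  refine ⟨p, hp, ?_⟩
  filter_upwards [ae_mem_interior_convexHull Ω t] with x hx hxt using hFp x (hx hxt)

/-- A piecewise polynomial field orthogonal to the gradients of all test functions is the Curl of a
function in `Y_h`. The primitive is square integrable since, being piecewise polynomial, it is
bounded; subtracting its mean puts it into `L²₀(Ω)`. -/
theorem exists_mem_Yh_hasWeakCurl {Ω : Set Plane} (hΩ : IsPolygonalDomain Ω)
    {𝒯 : Triangulation Ω} {k : ℕ} {q : L2Vec Ω} (hq : q ∈ Xh 𝒯 k)
    (h : ∀ g ∈ testGradients Ω, inner ℝ q g = 0) :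
    ∃ β ∈ Yh 𝒯 k, HasWeakCurl β q := by
  have hmeas := hΩ.isOpen.measurableSet
  have hfin : volume Ω < ⊤ := hΩ.isBounded.measure_lt_top
  have : IsFiniteMeasure (volume.restrict Ω) := ⟨by simpa using hfin⟩
  have hpos : volume.real Ω ≠ 0 :=
    (ENNReal.toReal_pos (hΩ.isOpen.measure_pos volume hΩ.isSimplyConnected.nonempty).ne'
      hfin.ne).ne'
  obtain ⟨F, hFc, hF, hFp⟩ := exists_isWeakPrimitive_of_mem_Xh hΩ hq h
  obtain ⟨M, hM⟩ := hFp.exists_ae_abs_le hΩ.isOpen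
  have hFm : AEStronglyMeasurable F (volume.restrict Ω) := hFc.aestronglyMeasurable hmeas
  let m : ℝ := (∫ x in Ω, F x) / volume.real Ω
  have hFL : MemLp F 2 (volume.restrict Ω) := MemLp.of_bound hFm M hM
  have hGL : MemLp (fun x ↦ F x - m) 2 (volume.restrict Ω) := hFL.sub (memLp_const m)
  have hβ := hGL.coeFn_toLp
  have hgrad : HasWeakGradient (hGL.toLp _) (quarterTurn.compLp q) := by
    rw [hasWeakGradient_iff]
    have hconst : IsWeakPrimitive Ω (fun x ↦ F x - m)
        (fun x ↦ innerSL ℝ (quarterTurn (q x))) := by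
      intro φ hφ v
      have h1 := isWeakPrimitive_of_hasFDerivAt (f := fun _ ↦ m) (η := 0)
        (fun y _ ↦ hasFDerivAt_const m y) continuousOn_const φ hφ v
      simp_rw [sub_mul]
      rw [integral_sub, hF φ hφ v, h1]
      · simp
      · exact integrable_mul_of_continuousOn hFc (hφ.continuous_fderiv_apply v)
          (hφ.hasCompactSupport_fderiv_apply v)
          ((tsupport_fderiv_apply_subset ℝ v).trans hφ.support)
      · exact ((hφ.continuous_fderiv_apply v).integrable_of_hasCompactSupport
          (hφ.hasCompactSupport_fderiv_apply v)).const_mul _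
    refine hconst.congr_ae hmeas ?_ ?_
    · filter_upwards [hβ] with x hx using hx.symm
    · filter_upwards [quarterTurn.coeFn_compLp q] with x hx
      rw [hx]
  refine ⟨hGL.toLp _, ⟨fun t ht ↦ ?_, ⟨_, hgrad⟩, ?_⟩, _, hgrad, ?_⟩
  · obtain ⟨p, hp, hpF⟩ := hFp t ht
    refine ⟨p - MvPolynomial.C m, (MvPolynomial.totalDegree_sub _ _).trans (by simp [hp]), ?_⟩
    filter_upwards [hβ, hpF] with x h1 h2 hxt
    rw [h1, h2 hxt]
    simp
  · change ∫ x in Ω, hGL.toLp (fun x ↦ F x - m) x = 0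
    rw [integral_congr_ae hβ, integral_sub (hFL.integrable one_le_two) (integrable_const m),
      setIntegral_const, smul_eq_mul, mul_div_cancel₀ _ hpos, sub_self]
  · filter_upwards [quarterTurn.coeFn_compLp q] with x hx
    rw [hx, quarterTurn_apply_zero, quarterTurn_apply_one, neg_neg]
    exact ⟨rfl, rfl⟩

/-! ### The projection property -/

theorem Xh_mono {Ω : Set Plane} {𝒯 𝒯' : Triangulation Ω} (h : Refines 𝒯' 𝒯) (k : ℕ) :
    Xh 𝒯 k ≤ Xh 𝒯' k := by
  intro q hq i t' ht'
  obtain ⟨t, ht, htt'⟩ := h t' ht'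
  obtain ⟨p, hp, hpq⟩ := hq i t ht
  exact ⟨p, hp, hpq.mono fun x hx hxt ↦ hx (htt' hxt)⟩

theorem projXh_mem {Ω : Set Plane} (𝒯 : Triangulation Ω) (k : ℕ) (g : L2Vec Ω) :
    projXh 𝒯 k g ∈ Xh 𝒯 k :=
  Submodule.starProjection_apply_mem _ g

theorem inner_projXh {Ω : Set Plane} {𝒯 : Triangulation Ω} {k : ℕ} {q : L2Vec Ω}
    (hq : q ∈ Xh 𝒯 k) (g : L2Vec Ω) : inner ℝ q (projXh 𝒯 k g) = inner ℝ q g := by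
  have h := Submodule.starProjection_inner_eq_zero (K := Xh 𝒯 k) g q hq
  rw [inner_sub_left, sub_eq_zero] at h
  rw [real_inner_comm, real_inner_comm g q]
  exact h.symm

theorem image_projXh_gradH1Zero_subset {Ω : Set Plane} (hΩ : IsOpen Ω) (𝒯 : Triangulation Ω)
    (k : ℕ) : projXh 𝒯 k '' gradH1Zero Ω ⊆ Wh 𝒯 k := by
  rintro _ ⟨g, hg, rfl⟩
  refine ⟨projXh_mem 𝒯 k g, fun β hβ c hc ↦ ?_⟩
  rw [real_inner_comm, inner_projXh (hc.mem_Xh hΩ hβ.1) g]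
  exact hc.inner_gradH1Zero_eq_zero hΩ hg

/-- Every discrete orthogonal gradient is the projection of the gradient of a test function. The
projections of these gradients form a subspace of the finite-dimensional space `X_h`, and its
orthogonal complement in `X_h` consists of Curls of functions in `Y_h`. -/
theorem Wh_subset_map_testGradients {Ω : Set Plane} (hΩ : IsPolygonalDomain Ω)
    (𝒯 : Triangulation Ω) (k : ℕ) :
    Wh 𝒯 k ⊆ (testGradients Ω).map (projXh 𝒯 k).toLinearMap := by
  rintro q ⟨hq, hqY⟩
  set K := (testGradients Ω).map (projXh 𝒯 k).toLinearMap with hK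
  have hKX : K ≤ Xh 𝒯 k := by
    rintro _ ⟨g, -, rfl⟩
    exact projXh_mem 𝒯 k g
  have : FiniteDimensional ℝ K := Submodule.finiteDimensional_of_le hKX
  have hmem : q ∈ Kᗮᗮ := by
    rw [Submodule.mem_orthogonal]
    intro x hx
    have hPx := projXh_mem 𝒯 k x
    obtain ⟨β, hβ, hβx⟩ := exists_mem_Yh_hasWeakCurl hΩ hPx fun g hg ↦ by
      rw [← inner_projXh hPx, real_inner_comm, inner_projXh (projXh_mem 𝒯 k g)]
      exact (Submodule.mem_orthogonal K x).1 hx _ ⟨g, hg, rfl⟩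
    have h0 := hqY β hβ _ hβx
    rw [inner_projXh hq] at h0
    rwa [real_inner_comm]
  rwa [Submodule.orthogonal_orthogonal] at hmem

theorem Wh_eq_image_projXh_gradH1Zero {Ω : Set Plane} (hΩ : IsPolygonalDomain Ω)
    (𝒯 : Triangulation Ω) (k : ℕ) : Wh 𝒯 k = projXh 𝒯 k '' gradH1Zero Ω := by
  refine Set.Subset.antisymm (fun q hq ↦ ?_) (image_projXh_gradH1Zero_subset hΩ.isOpen 𝒯 k)
  obtain ⟨g, hg, rfl⟩ := Wh_subset_map_testGradients hΩ 𝒯 k hq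
  exact ⟨g, testGradients_subset_gradH1Zero hΩ.isOpen hg, rfl⟩

theorem projXh_projXh_of_refines {Ω : Set Plane} {𝒯 𝒯' : Triangulation Ω} (h : Refines 𝒯' 𝒯)
    (k : ℕ) (g : L2Vec Ω) : projXh 𝒯 k (projXh 𝒯' k g) = projXh 𝒯 k g := by
  rw [← sub_eq_zero, ← map_sub]
  refine ext_inner_left ℝ fun v ↦ ?_
  have hv := projXh_mem 𝒯 k v
  rw [inner_zero_right, projXh, ← Submodule.inner_starProjection_left_eq_right]
  change inner ℝ (projXh 𝒯 k v) _ = 0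
  rw [inner_sub_right, inner_projXh (Xh_mono h k hv), sub_self]

end DiscGrad

theorem lemma3p2 (Ω : Set DiscGrad.Plane) (hΩ : DiscGrad.IsPolygonalDomain Ω)
    (𝒯 : DiscGrad.Triangulation Ω) (k : ℕ) :
    DiscGrad.Wh 𝒯 k = DiscGrad.projXh 𝒯 k '' DiscGrad.gradH1Zero Ω ∧
    ∀ 𝒯' : DiscGrad.Triangulation Ω, DiscGrad.IsAdmissibleRefinement 𝒯' 𝒯 →
      DiscGrad.projXh 𝒯 k '' DiscGrad.Wh 𝒯' k = DiscGrad.Wh 𝒯 k := by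
  refine ⟨DiscGrad.Wh_eq_image_projXh_gradH1Zero hΩ 𝒯 k, fun 𝒯' h𝒯' ↦ ?_⟩
  obtain ⟨_, _, -, -, -, href⟩ := h𝒯'
  rw [DiscGrad.Wh_eq_image_projXh_gradH1Zero hΩ, DiscGrad.Wh_eq_image_projXh_gradH1Zero hΩ,
    Set.image_image]
  exact Set.image_congr fun g _ ↦ DiscGrad.projXh_projXh_of_refines href k g
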